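/- **Setting.** Fix a smoothing level $\epsilon>0$ and a shift $\delta>0$. A loop-free program $P(\Theta)$ acts on real variables $x=(x_1,\dots,x_n)$ and depends on real parameters $\Theta=(\theta_1,\dots,\theta_m)$, each with an interval domain; a *coefficient* is a real constant or a parameter. Programs are built from $\mathtt{skip}$; assignments $\xi:=e$, where $e$ is a product $x_jx_k$ or a linear expression $\sum_i a_ix_i+a_0$ with coefficients $a_i$; random assignments $\xi\sim gm(\pi,\mu,\sigma)$ (a univariate Gaussian mixture whose weights, means and standard deviations are coefficients); $\mathtt{if}\ b\ \mathtt{then}\ P_1\ \mathtt{else}\ P_2$; $\mathtt{observe}(b)$; and $P_1;P_2$. Predicates $b$ are *true*, *false* or $\xi\bowtie c$ with a coefficient $c$ and $\bowtie\,\in\{<,\le,==,\ge,>\}$ ($==$ only in observations). A variable $x_i$ is *in* a linear expression unless its coefficient is the literal constant $0$. The *feasible set* $S$ consists of the $\Theta$ in the given domains such that, in every $gm(\pi,\mu,\sigma)$ of $P$, $\pi_j\ge 0$, $\sum_j\pi_j=1$, $\sigma_j\ge 0$, and $\sigma_j\neq 0$ whenever $\sigma_j$ is a parameter (constant $\sigma_j=0$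 is allowed); and in every linear assignment $\xi:=e$ with $\xi$ in $e$ the coefficient of $\xi$ is non-zero. **Exact semantics and validity.** A path $\omega$ of $P$ fixes the outcomes of the tests. Exactly, a path transforms $(1,\mathcal N(0,\mathbf I_n))$ node by node: assignments push the law forward; $\xi\sim gm(\pi,\mu,\sigma)$ replaces the law by the product of the marginal of the other variables and $gm(\pi,\mu,\sigma)$; tests and observations multiply $p$ by the probability of the event and condition on it (giving $p=0$ if the event has probability $0$). For $\mathtt{observe}(\xi==c)$ where $\xi$ has no atom at $c$, the density of $\xi$ at $c$ and the law conditioned to $\xi=c$ are used (both as limits over $|\xi-c|<h$, $h\downarrow0$; $p$ becomes $0$ if these limits do not exist or the density is $0$). $P(\Theta)$ is *valid* if some path has exact probability $p>0$. **Smoothed (DeGAS) semantics.** Let $\mathcal T$ replace each component of a mixture of laws on $\mathbb R^n$ by the Gaussian with the same mean and covariance matrix. A path transforms the triple $(1,\mathcal N(0,\mathbf I_n),\emptyset)$ node by node; a triple $(p,D,V)$ of a probability, a Gaussian mixture $D=\sum_i\pi_i\mathcal N(\mu_i,\Sigma_i)$ and a set $V$ of smoothed variables is mapped as follows ($\mathcal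 N(c,\epsilon)$ has standard deviation $\epsilon$). * $\mathtt{skip}$: unchanged. * $\xi:=e$: $D$ becomes the law of $x[\xi\to e+z]$ with independent $z\sim\mathcal N(0,\epsilon)$ if $e$ is linear and $\xi$ is not in $e$, and $\mathcal T$ of the law of $x[\xi\to e]$ otherwise; $\xi$ is added to $V$ if all variables in $e$ are in $V$. * $\xi\sim gm(\pi,\mu,\sigma)$: $D$ becomes the product of its marginal over the other variables and $gm(\pi,\mu,\sigma')$, where $\sigma'$ is $\sigma$ with zero entries replaced by $\epsilon$; $\xi$ is added to $V$ if some $\sigma_j=0$. * A test or observation of $b$, except for the case below: let $b'$ be $b$, but for $\xi\in V$ replace $\xi>c,\ \xi\ge c,\ \xi\le c,\ \xi<c,\ \xi==c$ by $\xi>c+\delta,\ \xi>c-\delta,\ \xi<c+\delta,\ \xi<c-\delta,\ c-\delta<\xi<c+\delta$ respectively. With $A=b'$ (observation, or test with outcome true) or $A=\neg b'$ (test with outcome false), $p$ becomes $p\cdot D(A)$ and $D$ becomes $\mathcal T(D|_A)$; if $D(A)=0$, then $p$ becomes $0$ and $D$ is kept. * $\mathtt{observe}(\xi==c)$ with $\xi\notin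 V$: with $f_D$ the density of $D$ and $I=\int_{\mathbb R^{n-1}}f_D(x[\xi\to c])\,d(x\setminus\xi)$, $p$ becomes $p\cdot I$, $D$ becomes the product of the law of $x\setminus\xi$ under $D|_{\xi=c}$ and $\mathcal N(c,\epsilon)$, and $\xi$ is added to $V$. If the path $\omega$ returns $(p_\omega(\Theta),D_\omega(\Theta),V_\omega)$, the program returns $p'(\Theta)=\sum_\omega p_\omega(\Theta)$ and $D'(\Theta)=\sum_\omega\frac{p_\omega(\Theta)}{p'(\Theta)}D_\omega(\Theta)$. Call a Gaussian mixture depending on $\Theta$ *differentiable on $S$* if on $S$ it has a fixed number of components, with weights that are non-negative and sum to one, if its weights, mean vectors and covariance matrices are differentiable in $\Theta\in S$ (differentiability within $S$), if all its covariance matrices are non-singular (positive definite) for all $\Theta\in S$, and if its density at every point $x\in\mathbb R^n$ is differentiable in $\Theta\in S$. **Theorem.** Let $P(\Theta)$ be valid for at least one $\Theta\in S$ (in particular, this holds if $S\ne\emptyset$ and $P(\Theta)$ is valid for every $\Theta\in S$). Then, for every path $\omega$ of $P$, $p_\omega(\Theta)$ and the Gaussian mixture $D_\omega(\Theta)$ are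 differentiable on $S$, and $V_\omega$ does not depend on $\Theta\in S$. Moreover $p'(\Theta)>0$ for all $\Theta\in S$, and $p'(\Theta)$ and the Gaussian mixture $D'(\Theta)$ are differentiable on $S$. -/

import Mathlib

open MeasureTheory ProbabilityTheory

noncomputable section

namespace DeGAS

/-! ## Syntax: programs over the variables `x : Fin n → ℝ` and the parameters `Θ : Fin m → ℝ` -/

/-- A coefficient is a real constant or a (named) parameter. -/
inductive Coef (m : ℕ) where
  | const (c : ℝ)
  | param (i : Fin m)

/-- Value of a coefficient at the parameter value `Θ`. -/
def Coef.eval {m : ℕ} (Θ : Fin m → ℝ) : Coef m → ℝ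
  | .const c => c
  | .param i => Θ i

/-- Expressions: products `x_j * x_k`, or linear expressions `∑ i, a i * x_i + a₀`. -/
inductive Expr (n m : ℕ) where
  | prod (j k : Fin n)
  | lin (a : Fin n → Coef m) (a₀ : Coef m)

/-- The map `ℝⁿ → ℝ` denoted by an expression. -/
def Expr.eval {n m : ℕ} (Θ : Fin m → ℝ) : Expr n m → (Fin n → ℝ) → ℝ
  | .prod j k, x => x j * x k
  | .lin a a₀, x => ∑ i, (a i).eval Θ * x i + a₀.eval Θ

open Classical in
/-- The variables that occur in an expression. This is a syntactic notion: in a linear expression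
`x_i` occurs unless its coefficient is the literal constant `0`. -/
def Expr.vars {n m : ℕ} : Expr n m → Finset (Fin n)
  | .prod j k => {j, k}
  | .lin a _ => Finset.univ.filter fun i => a i ≠ .const 0

/-- Comparison symbols. -/
inductive Cmp where
  | lt | le | eq | ge | gt

/-- Boolean predicates: `true`, `false`, or `x_ξ ⋈ c`. -/
inductive BExpr (n m : ℕ) where
  | tt
  | ff
  | cmp (ξ : Fin n) (r : Cmp) (c : Coef m)

/-- Predicates allowed as guards of conditionals: those without `==`. -/
def BExpr.IsGuard {n m : ℕ} : BExpr n m → Prop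
  | .cmp _ .eq _ => False
  | _ => True

/-- The set of states satisfying a predicate. -/
def BExpr.toSet {n m : ℕ} (Θ : Fin m → ℝ) : BExpr n m → Set (Fin n → ℝ)
  | .tt => Set.univ
  | .ff => ∅
  | .cmp ξ .lt c => {x | x ξ < c.eval Θ}
  | .cmp ξ .le c => {x | x ξ ≤ c.eval Θ}
  | .cmp ξ .eq c => {x | x ξ = c.eval Θ}
  | .cmp ξ .ge c => {x | c.eval Θ ≤ x ξ}
  | .cmp ξ .gt c => {x | c.eval Θ < x ξ}

/-- One component (weight, mean, standard deviation) of a primitive `gm(π, μ, σ)`. -/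
structure RndComp (m : ℕ) where
  weight : Coef m
  mean : Coef m
  std : Coef m

/-- Loop-free programs. -/
inductive Prog (n m : ℕ) where
  | skip
  | assign (ξ : Fin n) (e : Expr n m)
  | rnd (ξ : Fin n) (gm : List (RndComp m))
  | ite (b : BExpr n m) (hb : b.IsGuard) (P Q : Prog n m)
  | observe (b : BExpr n m)
  | seq (P Q : Prog n m)

/-- Nodes of a path between `entry` and `exit`. A `test` node carries the outcome that the path
takes. -/
inductive Node (n m : ℕ) where
  | skip
  | assign (ξ : Fin n) (e : Expr n m)
  | rnd (ξ : Fin n) (gm : List (RndComp m))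
  | test (b : BExpr n m) (outcome : Bool)
  | observe (b : BExpr n m)

/-- The paths of the control-flow graph of a program. -/
def Prog.paths {n m : ℕ} : Prog n m → List (List (Node n m))
  | .skip => [[.skip]]
  | .assign ξ e => [[.assign ξ e]]
  | .rnd ξ gm => [[.rnd ξ gm]]
  | .ite b _ P Q => P.paths.map (Node.test b true :: ·) ++ Q.paths.map (Node.test b false :: ·)
  | .observe b => [[.observe b]]
  | .seq P Q => P.paths.flatMap fun ω => Q.paths.map (ω ++ ·)

/-- The constraints which a program puts on the parameters:
* in every `gm(π, μ, σ)` the weights are nonnegative and sum to one, the standard deviations are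
  nonnegative, and those that are given by a parameter do not vanish
  (a *constant* standard deviation may be zero);
* in every linear assignment `ξ := e` with `ξ` in `e`, the coefficient of `ξ` does not vanish. -/
def Prog.Admissible {n m : ℕ} (Θ : Fin m → ℝ) : Prog n m → Prop
  | .skip => True
  | .assign ξ (.lin a a₀) => ξ ∈ (Expr.lin a a₀).vars → (a ξ).eval Θ ≠ 0
  | .assign _ (.prod _ _) => True
  | .rnd _ gm =>
      (∀ g ∈ gm, 0 ≤ g.weight.eval Θ ∧ 0 ≤ g.std.eval Θ ∧
        ∀ i, g.std = .param i → Θ i ≠ 0) ∧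
      (gm.map fun g => g.weight.eval Θ).sum = 1
  | .ite _ _ P Q => P.Admissible Θ ∧ Q.Admissible Θ
  | .observe _ => True
  | .seq P Q => P.Admissible Θ ∧ Q.Admissible Θ

/-- The parameter values in the given domains that satisfy the constraints of the program. -/
def Prog.feasible {n m : ℕ} (P : Prog n m) (dom : Fin m → Set ℝ) : Set (Fin m → ℝ) :=
  {Θ | (∀ i, Θ i ∈ dom i) ∧ P.Admissible Θ}

/-! ## Probability distributions on the state space -/

/-- The univariate normal law with mean `μ` and *standard deviation* `s`. -/
def normal (μ s : ℝ) : Measure ℝ := gaussianReal μ ⟨s ^ 2, sq_nonneg s⟩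

/-- The normal law on `ℝⁿ` with mean vector `μ` and covariance matrix `S`. -/
def gaussian {n : ℕ} (μ : Fin n → ℝ) (S : Matrix (Fin n) (Fin n) ℝ) : Measure (Fin n → ℝ) :=
  (multivariateGaussian (WithLp.toLp 2 μ) S).map WithLp.ofLp

/-- The density of the normal law on `ℝⁿ` with mean `μ` and nonsingular covariance matrix `S`. -/
def gaussianPDF {n : ℕ} (μ : Fin n → ℝ) (S : Matrix (Fin n) (Fin n) ℝ) (x : Fin n → ℝ) : ℝ :=
  (Real.sqrt ((2 * Real.pi) ^ n * S.det))⁻¹ *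
    Real.exp (-(1 / 2) * ((x - μ) ⬝ᵥ (S⁻¹).mulVec (x - μ)))

/-- The state with `ξ`-coordinate `t` and remaining coordinates `y`. -/
def glue {n : ℕ} (ξ : Fin n) (y : {j : Fin n // j ≠ ξ} → ℝ) (t : ℝ) : Fin n → ℝ :=
  fun j => if h : j = ξ then t else y ⟨j, h⟩

/-- The marginal of `D` over all variables but `ξ`. -/
def dropVar {n : ℕ} (ξ : Fin n) (D : Measure (Fin n → ℝ)) :
    Measure ({j : Fin n // j ≠ ξ} → ℝ) :=
  D.map fun x j => x j

/-- The product law `D₁ ⊗ D₂`, where `D₁` is the law of the variables other than `ξ`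
and `D₂` is the law of `ξ`. -/
def tensor {n : ℕ} (ξ : Fin n) (D₁ : Measure ({j : Fin n // j ≠ ξ} → ℝ)) (D₂ : Measure ℝ) :
    Measure (Fin n → ℝ) :=
  (D₁.prod D₂).map fun q => glue ξ q.1 q.2

/-- A component of a Gaussian mixture: a weight together with `N(mean, cov)`. -/
@[ext] structure GComp (n : ℕ) where
  weight : ℝ
  mean : Fin n → ℝ
  cov : Matrix (Fin n) (Fin n) ℝ

/-- The normal law of a component. -/
def GComp.law {n : ℕ} (g : GComp n) : Measure (Fin n → ℝ) := gaussian g.mean g.cov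

/-- A Gaussian mixture on `ℝⁿ`, as the list of its components. -/
abbrev GM (n : ℕ) := List (GComp n)

/-- The probability of a set under a mixture. -/
def GM.prob {n : ℕ} (D : GM n) (s : Set (Fin n → ℝ)) : ℝ :=
  (D.map fun g => g.weight * g.law.real s).sum

/-- The density of a mixture with nonsingular covariance matrices. -/
def GM.pdf {n : ℕ} (D : GM n) (x : Fin n → ℝ) : ℝ :=
  (D.map fun g => g.weight * gaussianPDF g.mean g.cov x).sum

/-- The moment-matching operator on one component: the normal law with the mean vector and the
covariance matrix of `D`, with weight `w`. -/
def momentMatch {n : ℕ} (w : ℝ) (D : Measure (Fin n → ℝ)) : GComp n where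
  weight := w
  mean := fun i => ∫ x, x i ∂D
  cov := Matrix.of fun i j => cov[fun x => x i, fun x => x j; D]

/-- Moment matching leaves normal laws unaltered. -/
theorem momentMatch_gaussian {n : ℕ} (w : ℝ) (μ : Fin n → ℝ) {S : Matrix (Fin n) (Fin n) ℝ}
    (hS : S.PosSemidef) : momentMatch w (gaussian μ S) = ⟨w, μ, S⟩ := by
  have hm : Measurable (WithLp.ofLp : EuclideanSpace ℝ (Fin n) → Fin n → ℝ) := by fun_prop
  ext i j
  · rfl
  · have h := congrArg (fun v : EuclideanSpace ℝ (Fin n) => v i)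
      (integral_id_multivariateGaussian (μ := WithLp.toLp 2 μ) (S := S))
    have h2 := (EuclideanSpace.proj i : EuclideanSpace ℝ (Fin n) →L[ℝ] ℝ).integral_comp_comm
      (IsGaussian.integrable_id (μ := multivariateGaussian (WithLp.toLp 2 μ) S))
    simp only [momentMatch, gaussian]
    rw [integral_map hm.aemeasurable (measurable_pi_apply i).aestronglyMeasurable]
    simpa using h2.trans h
  · simp only [momentMatch, gaussian, Matrix.of_apply]
    rw [covariance_map (measurable_pi_apply i).aestronglyMeasurable
      (measurable_pi_apply j).aestronglyMeasurable hm.aemeasurable]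
    exact covariance_eval_multivariateGaussian hS i j

/-! ## The exact semantics -/

/-- `I` is the density of the variable `ξ` under `D` at the point `c`, and `D'` is the law `D`
conditioned to `ξ = c`: both are limits over the events `|ξ - c| < h` as `h` decreases to `0`. -/
def IsPointConditioning {n : ℕ} (D : Measure (Fin n → ℝ)) (ξ : Fin n) (c : ℝ)
    (I : ℝ) (D' : Measure (Fin n → ℝ)) : Prop :=
  Filter.Tendsto (fun h : ℝ => D.real {x | |x ξ - c| < h} / (2 * h))
      (nhdsWithin 0 (Set.Ioi 0)) (nhds I) ∧
  IsProbabilityMeasure D' ∧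
  ∀ f : BoundedContinuousFunction (Fin n → ℝ) ℝ,
    Filter.Tendsto (fun h : ℝ => ∫ x, f x ∂(cond D {x | |x ξ - c| < h}))
      (nhdsWithin 0 (Set.Ioi 0)) (nhds (∫ x, f x ∂D'))

open Classical in
/-- Conditioning on an event of positive probability; otherwise the probability becomes `0`. -/
def exactCond {n : ℕ} (s : Set (Fin n → ℝ)) (q : ℝ × Measure (Fin n → ℝ)) :
    ℝ × Measure (Fin n → ℝ) :=
  if q.2.real s = 0 then (0, q.2) else (q.1 * q.2.real s, cond q.2 s)

open Classical in
/-- Exact semantics of `observe (ξ == c)`. If `ξ` has an atom at `c` this is ordinary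
conditioning, otherwise the density of `ξ` at `c` is used. -/
def exactObserveEq {n : ℕ} (ξ : Fin n) (c : ℝ) (q : ℝ × Measure (Fin n → ℝ)) :
    ℝ × Measure (Fin n → ℝ) :=
  if q.2.real {x | x ξ = c} ≠ 0 then exactCond {x | x ξ = c} q
  else if h : ∃ r : ℝ × Measure (Fin n → ℝ), 0 < r.1 ∧ IsPointConditioning q.2 ξ c r.1 r.2 then
    (q.1 * h.choose.1, h.choose.2)
  else (0, q.2)

/-- The mixture law `gm(π, μ, σ)` on `ℝ`. -/
def rndLaw {m : ℕ} (Θ : Fin m → ℝ) (gm : List (RndComp m)) : Measure ℝ :=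
  (gm.map fun g => ENNReal.ofReal (g.weight.eval Θ) •
    normal (g.mean.eval Θ) (g.std.eval Θ)).sum

/-- Exact semantics of a node, acting on pairs (probability, distribution). -/
def exactNode {n m : ℕ} (Θ : Fin m → ℝ) :
    Node n m → ℝ × Measure (Fin n → ℝ) → ℝ × Measure (Fin n → ℝ)
  | .skip, q => q
  | .assign ξ e, q => (q.1, q.2.map fun x => Function.update x ξ (e.eval Θ x))
  | .rnd ξ gm, q => (q.1, tensor ξ (dropVar ξ q.2) (rndLaw Θ gm))
  | .test b true, q => exactCond (b.toSet Θ) q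
  | .test b false, q => exactCond (b.toSet Θ)ᶜ q
  | .observe (.cmp ξ .eq c), q => exactObserveEq ξ (c.eval Θ) q
  | .observe b, q => exactCond (b.toSet Θ) q

/-- Exact semantics of a path, started (at the entry node) from `(1, N(0, I))`. -/
def exactPath {n m : ℕ} (Θ : Fin m → ℝ) (ω : List (Node n m)) : ℝ × Measure (Fin n → ℝ) :=
  ω.foldl (fun q v => exactNode Θ v q) (1, gaussian 0 1)

/-- A program is valid if some path has positive probability in the exact semantics. -/
def Prog.Valid {n m : ℕ} (Θ : Fin m → ℝ) (P : Prog n m) : Prop :=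
  ∃ ω ∈ P.paths, 0 < (exactPath Θ ω).1

/-! ## The smoothed semantics

`ε > 0` is the standard deviation of the smoothing noise and `δ > 0` the shift of the predicates. -/

open Classical in
/-- The set denoted by the smoothed predicate, given the set `V` of smoothed variables. -/
def BExpr.smooth {n m : ℕ} (δ : ℝ) (Θ : Fin m → ℝ) (V : Finset (Fin n)) :
    BExpr n m → Set (Fin n → ℝ)
  | .cmp ξ r c =>
      if ξ ∈ V then
        match r with
        | .gt => {x | c.eval Θ + δ < x ξ}
        | .ge => {x | c.eval Θ - δ < x ξ}
        | .le => {x | x ξ < c.eval Θ + δ}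
        | .lt => {x | x ξ < c.eval Θ - δ}
        | .eq => {x | c.eval Θ - δ < x ξ ∧ x ξ < c.eval Θ + δ}
      else (BExpr.cmp ξ r c).toSet Θ
  | b => b.toSet Θ

/-- The triples (probability, Gaussian mixture, smoothed variables). -/
structure State (n : ℕ) where
  p : ℝ
  D : GM n
  V : Finset (Fin n)

/-- The output of the entry node. -/
def entry (n : ℕ) : State n := ⟨1, [⟨1, 0, 1⟩], ∅⟩

open Classical in
/-- Moment matching of the law of `x[ξ → e]`, or of `x[ξ → e + z]` with an independent
`z ∼ N(0, ε)` if `e` is linear and `ξ` is not in `e`, for each component. In the linear cases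
these laws are already normal. (If `e` is constant, then `e.vars = ∅`, so `ξ` is
added to `V`.) -/
def assignStep {n m : ℕ} (ε : ℝ) (Θ : Fin m → ℝ) (ξ : Fin n) (e : Expr n m) (s : State n) :
    State n where
  p := s.p
  D := s.D.map fun g => momentMatch g.weight <|
    match e with
    | .lin _ _ =>
        if ξ ∈ e.vars then g.law.map fun x => Function.update x ξ (e.eval Θ x)
        else (g.law.prod (normal 0 ε)).map fun q => Function.update q.1 ξ (e.eval Θ q.1 + q.2)
    | .prod _ _ => g.law.map fun x => Function.update x ξ (e.eval Θ x)
  V := if e.vars ⊆ s.V then insert ξ s.V else s.V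

open Classical in
/-- Random assignment: a zero standard deviation is replaced by `ε`. The components of
`Marg(D) ⊗ gm(π, μ, σ')` are the products of a component of the marginal and one of the `gm`
(these products are normal laws, described by their moments). -/
def rndStep {n m : ℕ} (ε : ℝ) (Θ : Fin m → ℝ) (ξ : Fin n) (gm : List (RndComp m))
    (s : State n) : State n where
  p := s.p
  D := s.D.flatMap fun g => gm.map fun r =>
    momentMatch (g.weight * r.weight.eval Θ) <|
      tensor ξ (dropVar ξ g.law)
        (normal (r.mean.eval Θ) (if r.std.eval Θ = 0 then ε else r.std.eval Θ))
  V := if ∃ r ∈ gm, r.std.eval Θ = 0 then insert ξ s.V else s.V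

open Classical in
/-- Conditioning to a set and moment matching. The components of `D` conditioned to `A` are the
conditioned components of `D`, weighted with their relative probabilities of `A`. If `A` has
probability zero then the probability of the path becomes `0`, and the distribution is kept. -/
def condStep {n : ℕ} (A : Set (Fin n → ℝ)) (s : State n) : State n :=
  if GM.prob s.D A = 0 then ⟨0, s.D, s.V⟩
  else
    { p := s.p * GM.prob s.D A
      D := s.D.map fun g =>
        momentMatch (g.weight * g.law.real A / GM.prob s.D A) (cond g.law A)
      V := s.V }

/-- The integral of the density of a component over the hyperplane `x_ξ = c`. -/
def GComp.slice {n : ℕ} (g : GComp n) (ξ : Fin n) (c : ℝ) : ℝ :=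
  ∫ y, gaussianPDF g.mean g.cov (glue ξ y c)

/-- The integral of the density of a mixture over the hyperplane `x_ξ = c`. -/
def GM.slice {n : ℕ} (D : GM n) (ξ : Fin n) (c : ℝ) : ℝ :=
  (D.map fun g => g.weight * g.slice ξ c).sum

/-- The law of the variables other than `ξ` under a component conditioned to `x_ξ = c`. -/
def GComp.condSlice {n : ℕ} (g : GComp n) (ξ : Fin n) (c : ℝ) :
    Measure ({j : Fin n // j ≠ ξ} → ℝ) :=
  volume.withDensity fun y =>
    ENNReal.ofReal (gaussianPDF g.mean g.cov (glue ξ y c) / g.slice ξ c)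

/-- `observe (ξ == c)` for a variable `ξ` that is not smoothed: the result is
`Marg(D | ξ = c) ⊗ N(c, ε)`, whose components are normal laws (described by their moments). -/
def observeEqStep {n : ℕ} (ε : ℝ) (ξ : Fin n) (c : ℝ) (s : State n) : State n where
  p := s.p * GM.slice s.D ξ c
  D := s.D.map fun g =>
    momentMatch (g.weight * g.slice ξ c / GM.slice s.D ξ c)
      (tensor ξ (g.condSlice ξ c) (normal c ε))
  V := insert ξ s.V

open Classical in
/-- The smoothed semantics of a node. -/
def node {n m : ℕ} (ε δ : ℝ) (Θ : Fin m → ℝ) : Node n m → State n → State n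
  | .skip, s => s
  | .assign ξ e, s => assignStep ε Θ ξ e s
  | .rnd ξ gm, s => rndStep ε Θ ξ gm s
  | .test b true, s => condStep (b.smooth δ Θ s.V) s
  | .test b false, s => condStep (b.smooth δ Θ s.V)ᶜ s
  | .observe (.cmp ξ .eq c), s =>
      if ξ ∈ s.V then condStep ((BExpr.cmp ξ .eq c).smooth δ Θ s.V) s
      else observeEqStep ε ξ (c.eval Θ) s
  | .observe b, s => condStep (b.smooth δ Θ s.V) s

/-- The smoothed semantics of a path. -/
def path {n m : ℕ} (ε δ : ℝ) (Θ : Fin m → ℝ) (ω : List (Node n m)) : State n :=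
  ω.foldl (fun s v => node ε δ Θ v s) (entry n)

/-- The total probability of a program: the sum over its paths. -/
def progProb {n m : ℕ} (ε δ : ℝ) (Θ : Fin m → ℝ) (P : Prog n m) : ℝ :=
  (P.paths.map fun ω => (path ε δ Θ ω).p).sum

/-- The smoothed semantics of a program: the mixture of its paths, weighted with their relative
probabilities. -/
def progDist {n m : ℕ} (ε δ : ℝ) (Θ : Fin m → ℝ) (P : Prog n m) : GM n :=
  P.paths.flatMap fun ω => (path ε δ Θ ω).D.map fun g =>
    { g with weight := (path ε δ Θ ω).p / progProb ε δ Θ P * g.weight }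

/-! ## Differentiable Gaussian mixtures -/

/-- On `S`, the mixtures `D Θ` have a fixed number `k` of components, nonnegative weights that sum
to one, weights, means and covariance matrices that are differentiable in `Θ`, and nonsingular
(that is, positive definite) covariance matrices. -/
def DifferentiableGM {n m : ℕ} (D : (Fin m → ℝ) → GM n) (S : Set (Fin m → ℝ)) : Prop :=
  ∃ (k : ℕ) (w : Fin k → (Fin m → ℝ) → ℝ) (μ : Fin k → (Fin m → ℝ) → Fin n → ℝ)
    (C : Fin k → (Fin m → ℝ) → Matrix (Fin n) (Fin n) ℝ),
    (∀ Θ ∈ S, D Θ = List.ofFn fun i => ⟨w i Θ, μ i Θ, C i Θ⟩) ∧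
    (∀ Θ ∈ S, (∀ i, 0 ≤ w i Θ) ∧ ∑ i, w i Θ = 1) ∧
    (∀ i, DifferentiableOn ℝ (w i) S) ∧
    (∀ i j, DifferentiableOn ℝ (fun Θ => μ i Θ j) S) ∧
    (∀ i j l, DifferentiableOn ℝ (fun Θ => C i Θ j l) S) ∧
    (∀ i, ∀ Θ ∈ S, (C i Θ).PosDef)

end DeGAS

end

noncomputable section

namespace DeGAS

/-! ## Exponential families: differentiability in the natural parameter -/

/-! The proof carries an invariant along a path (`DiffState`): the mixture is a fixed list of
components whose weights, means and covariances are differentiable on S and whose covariances are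
positive definite, the path probability is differentiable and nonnegative, and V is constant.
`DiffState.node` shows that every node preserves it.

Differentiability has a single source. Every new weight, mean or covariance is built from integrals
of functions of exponential growth (in fact polynomials) against a Gaussian density, over the whole
space, an event or a hyperplane. A translation makes the event or hyperplane independent of Θ
(`gaussian_real_shift`, `gaussianPDF_glue`), so that Θ enters only through mean and covariance. In
natural parameters the density is a smooth factor times the exponential of a linear function of the
parameter, and a Laplace transform is differentiable in the interior of its domain of convergence.
This is `differentiableOn_integral_mul_gaussianPDF`, stated for an arbitrary base measure with
Gaussian tails so that all these cases, and the pointwise density, are instances of it.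

Positive definiteness means that the new law does not live on a hyperplane (`Nondeg.posDef`).
Conditioned laws on events are absolutely continuous. The other new laws are images of laws with
full support under continuous maps, and evaluation at a few points shows that such an image lies in
no hyperplane. The noise ε and the nonvanishing coefficient of ξ are used exactly here.

Positivity of p' rests on a dichotomy that does not depend on Θ. The event of a test or observation
either is a translate of a fixed set of positive volume, hence has positive probability for every Θ
in S, or is empty for every Θ, and then the exact probability vanishes too; a slice integral is
always positive. So a path that is exactly possible at one Θ₀ has positive smoothed probability on
all of S (`diffState_foldl`), and validity at a single point suffices. -/

/-- The Laplace transform of a vector-valued statistic, weighted by `f`, is differentiable in the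
interior of its domain of convergence. -/
theorem differentiableAt_integral_mul_exp {α E : Type*} [MeasurableSpace α] {ν : Measure α}
    [NormedAddCommGroup E] [NormedSpace ℝ E] {L : α → E →L[ℝ] ℝ} {f : α → ℝ} {η₀ : E} {s : ℝ}
    (hs : 0 < s) (hL : AEStronglyMeasurable L ν) (hf : AEStronglyMeasurable f ν)
    (hint : Integrable (fun x => f x * Real.exp (L x η₀ + s * ‖L x‖)) ν) :
    DifferentiableAt ℝ (fun η => ∫ x, f x * Real.exp (L x η) ∂ν) η₀ := by
  have hLη : ∀ η, AEStronglyMeasurable (fun x => L x η) ν := fun η =>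
    (ContinuousLinearMap.apply ℝ ℝ η).continuous.comp_aestronglyMeasurable hL
  have hm : ∀ η, AEStronglyMeasurable (fun x => f x * Real.exp (L x η)) ν := fun η =>
    hf.mul (Real.continuous_exp.comp_aestronglyMeasurable (hLη η))
  -- On the ball of radius s/2 the exponent grows by at most (s/2)‖L x‖. The other half of the
  -- margin s absorbs the factor ‖L x‖ of the derivative through t ≤ exp t, which produces the
  -- constant 2/s.
  refine (hasFDerivAt_integral_of_dominated_of_fderiv_le (𝕜 := ℝ)
    (F' := fun η x => (f x * Real.exp (L x η)) • L x)
    (bound := fun x => (2 / s) * ‖f x * Real.exp (L x η₀ + s * ‖L x‖)‖)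
    (Metric.ball_mem_nhds η₀ (half_pos hs)) (Filter.Eventually.of_forall hm) ?_ ?_ ?_ ?_
    ?_).differentiableAt
  · refine hint.mono (hm η₀) (Filter.Eventually.of_forall fun x => ?_)
    rw [norm_mul, norm_mul, Real.norm_of_nonneg (Real.exp_pos _).le,
      Real.norm_of_nonneg (Real.exp_pos _).le]
    gcongr
    have := mul_nonneg hs.le (norm_nonneg (L x))
    linarith
  · exact (hm η₀).smul hL
  · refine Filter.Eventually.of_forall fun x η hη => ?_
    rw [norm_smul, norm_mul, norm_mul, Real.norm_of_nonneg (Real.exp_pos _).le,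
      Real.norm_of_nonneg (Real.exp_pos _).le]
    have h1 : L x η ≤ L x η₀ + s / 2 * ‖L x‖ := by
      have h2 : L x (η - η₀) ≤ ‖L x‖ * ‖η - η₀‖ :=
        (le_abs_self _).trans ((L x).le_opNorm _)
      have h3 : ‖η - η₀‖ ≤ s / 2 := by
        rw [← dist_eq_norm]; exact (Metric.mem_ball.1 hη).le
      rw [map_sub] at h2
      nlinarith [norm_nonneg (L x)]
    have h4 : ‖L x‖ ≤ 2 / s * Real.exp (s / 2 * ‖L x‖) := by
      have := Real.add_one_le_exp (s / 2 * ‖L x‖)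
      calc ‖L x‖ = 2 / s * (s / 2 * ‖L x‖) := by field_simp
        _ ≤ _ := by gcongr; linarith
    calc ‖f x‖ * Real.exp (L x η) * ‖L x‖
        ≤ ‖f x‖ * Real.exp (L x η₀ + s / 2 * ‖L x‖) *
          (2 / s * Real.exp (s / 2 * ‖L x‖)) := by gcongr
      _ = 2 / s * (‖f x‖ * (Real.exp (L x η₀ + s / 2 * ‖L x‖) *
            Real.exp (s / 2 * ‖L x‖))) := by ring
      _ = _ := by rw [← Real.exp_add]; congr 3; ring
  · exact hint.norm.const_mul _
  · refine Filter.Eventually.of_forall fun x η _ => ?_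
    have h := ((L x).hasFDerivAt (x := η)).exp.const_mul (f x)
    rwa [smul_smul] at h

/-! ## Functions of exponential growth and measures with Gaussian tails -/

/-- A continuous function which is bounded by an exponential of the norm. -/
def ExpGrowth {n : ℕ} (f : (Fin n → ℝ) → ℝ) : Prop :=
  Continuous f ∧ ∃ K k : ℝ, 0 ≤ K ∧ ∀ x, |f x| ≤ K * Real.exp (k * ‖x‖)

theorem ExpGrowth.mul {n : ℕ} {f g : (Fin n → ℝ) → ℝ} (hf : ExpGrowth f) (hg : ExpGrowth g) :
    ExpGrowth fun x => f x * g x := by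
  obtain ⟨hf, K, k, hK, h⟩ := hf
  obtain ⟨hg, K', k', hK', h'⟩ := hg
  refine ⟨hf.mul hg, K * K', k + k', mul_nonneg hK hK', fun x => ?_⟩
  rw [abs_mul, add_mul, Real.exp_add]
  calc |f x| * |g x| ≤ (K * Real.exp (k * ‖x‖)) * (K' * Real.exp (k' * ‖x‖)) := by
        gcongr
        · exact h x
        · exact h' x
    _ = _ := by ring

theorem ExpGrowth.apply {n : ℕ} (i : Fin n) : ExpGrowth fun x : Fin n → ℝ => x i := by
  refine ⟨continuous_apply i, 1, 1, zero_le_one, fun x => ?_⟩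
  have h1 := norm_le_pi_norm x i
  have h2 := Real.add_one_le_exp ‖x‖
  rw [Real.norm_eq_abs] at h1
  rw [one_mul, one_mul]
  linarith

theorem ExpGrowth.const {n : ℕ} (c : ℝ) : ExpGrowth fun _ : Fin n → ℝ => c :=
  ⟨continuous_const, |c|, 0, abs_nonneg c, fun x => by simp⟩

/-- Measures for which all Gaussian functions are integrable. -/
def GaussTail {n : ℕ} (ν : Measure (Fin n → ℝ)) : Prop :=
  ∀ l : ℝ, 0 < l → Integrable (fun x => Real.exp (-(l * ‖x‖ ^ 2))) ν

/-- Completing the square: the exponents linear in ‖x‖, of total rate a + k, cost half of the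
quadratic decay and the constant (a + k)² / (2l), which is the maximum of (a + k)t - lt²/2. -/
theorem GaussTail.integrable {n : ℕ} {ν : Measure (Fin n → ℝ)} (hν : GaussTail ν)
    {f : (Fin n → ℝ) → ℝ} (hf : ExpGrowth f) {g : (Fin n → ℝ) → ℝ} (hg : Continuous g)
    {l a b : ℝ} (hl : 0 < l) (hgl : ∀ x, g x ≤ b + a * ‖x‖ - l * ‖x‖ ^ 2) :
    Integrable (fun x => f x * Real.exp (g x)) ν := by
  obtain ⟨hf, K, k, hK, h⟩ := hf
  refine ((hν (l / 2) (half_pos hl)).const_mul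
    (K * Real.exp (b + (a + k) ^ 2 / (2 * l)))).mono
    (by fun_prop) (Filter.Eventually.of_forall fun x => ?_)
  rw [norm_mul, Real.norm_of_nonneg (Real.exp_pos _).le, Real.norm_eq_abs,
    Real.norm_of_nonneg (by positivity)]
  calc |f x| * Real.exp (g x)
      ≤ K * Real.exp (k * ‖x‖) * Real.exp (b + a * ‖x‖ - l * ‖x‖ ^ 2) := by
        gcongr
        · exact h x
        · exact hgl x
    _ = K * Real.exp (k * ‖x‖ + (b + a * ‖x‖ - l * ‖x‖ ^ 2)) := by
        rw [Real.exp_add, mul_assoc]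
    _ ≤ K * Real.exp (b + (a + k) ^ 2 / (2 * l) + -(l / 2 * ‖x‖ ^ 2)) := by
        refine mul_le_mul_of_nonneg_left (Real.exp_le_exp.2 ?_) hK
        have : (a + k) * ‖x‖ ≤ (a + k) ^ 2 / (2 * l) + l / 2 * ‖x‖ ^ 2 := by
          have h0 : (a + k) ^ 2 / (2 * l) + l / 2 * ‖x‖ ^ 2 - (a + k) * ‖x‖
              = ((a + k) - l * ‖x‖) ^ 2 / (2 * l) := by field_simp; ring
          have h1 : 0 ≤ ((a + k) - l * ‖x‖) ^ 2 / (2 * l) := by positivity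
          linarith
        linarith
    _ = _ := by rw [Real.exp_add (b + _), mul_assoc]

/-- The natural parameters (precision matrix `Q` and `Q μ`) of a normal law. -/
abbrev NatParam (n : ℕ) : Type := (Fin n → Fin n → ℝ) × (Fin n → ℝ)

/-- The exponent `b ⬝ x - x ⬝ Q x / 2` as a linear function of the natural parameters. -/
def natExponent {n : ℕ} (x : Fin n → ℝ) : NatParam n →L[ℝ] ℝ :=
  (∑ i, x i • (ContinuousLinearMap.proj i ∘L ContinuousLinearMap.snd ℝ _ _)) -
    (1 / 2 : ℝ) • ∑ i, ∑ j, (x i * x j) •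
      ((ContinuousLinearMap.proj j : (Fin n → ℝ) →L[ℝ] ℝ) ∘L
        (ContinuousLinearMap.proj i : (Fin n → Fin n → ℝ) →L[ℝ] (Fin n → ℝ)) ∘L
          ContinuousLinearMap.fst ℝ _ _)

theorem natExponent_apply {n : ℕ} (x : Fin n → ℝ) (η : NatParam n) :
    natExponent x η = η.2 ⬝ᵥ x - 1 / 2 * (x ⬝ᵥ (Matrix.of η.1).mulVec x) := by
  simp only [natExponent, dotProduct, Matrix.mulVec, Finset.mul_sum, sub_eq_add_neg]
  simp [Finset.mul_sum]
  congr 1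
  · exact Finset.sum_congr rfl fun i _ => mul_comm _ _
  · refine congrArg Neg.neg (Finset.sum_congr rfl fun i _ => Finset.sum_congr rfl fun j _ => ?_)
    ring

theorem continuous_natExponent {n : ℕ} : Continuous (natExponent (n := n)) := by
  unfold natExponent
  fun_prop

theorem abs_dotProduct_le {n : ℕ} (b x : Fin n → ℝ) : |b ⬝ᵥ x| ≤ n * (‖b‖ * ‖x‖) := by
  calc |b ⬝ᵥ x| ≤ ∑ i, |b i * x i| := Finset.abs_sum_le_sum_abs _ _
    _ ≤ ∑ _i : Fin n, ‖b‖ * ‖x‖ := by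
        gcongr with i
        rw [abs_mul]
        gcongr
        · exact norm_le_pi_norm b i
        · exact norm_le_pi_norm x i
    _ = _ := by simp

theorem norm_natExponent_le {n : ℕ} (x : Fin n → ℝ) :
    ‖natExponent x‖ ≤ n * ‖x‖ + n ^ 2 * ‖x‖ ^ 2 := by
  refine ContinuousLinearMap.opNorm_le_bound _ (by positivity) fun η => ?_
  rw [natExponent_apply, Real.norm_eq_abs]
  have h1 := abs_dotProduct_le η.2 x
  have h2 := abs_dotProduct_le x ((Matrix.of η.1).mulVec x)
  have h3 : ‖(Matrix.of η.1).mulVec x‖ ≤ n * (‖η.1‖ * ‖x‖) := by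
    refine (pi_norm_le_iff_of_nonneg (by positivity)).2 fun i => ?_
    refine (abs_dotProduct_le (η.1 i) x).trans ?_
    gcongr
    exact norm_le_pi_norm η.1 i
  have h4 : ‖η.2‖ ≤ ‖η‖ := norm_snd_le η
  have h5 : ‖η.1‖ ≤ ‖η‖ := norm_fst_le η
  have h6 : |η.2 ⬝ᵥ x| ≤ n * (‖η‖ * ‖x‖) := h1.trans (by gcongr)
  have h7 : |x ⬝ᵥ (Matrix.of η.1).mulVec x| ≤ n * (‖x‖ * (n * (‖η‖ * ‖x‖))) :=
    h2.trans (by gcongr; exact h3.trans (by gcongr))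
  have h8 := abs_sub (η.2 ⬝ᵥ x) (1 / 2 * (x ⬝ᵥ (Matrix.of η.1).mulVec x))
  rw [abs_mul, abs_of_pos (by norm_num : (0:ℝ) < 1 / 2)] at h8
  have h9 : 0 ≤ |x ⬝ᵥ (Matrix.of η.1).mulVec x| := abs_nonneg _
  nlinarith

/-- A positive definite quadratic form is bounded below by a multiple of the squared norm. -/
theorem exists_le_dotProduct_mulVec {n : ℕ} {Q : Matrix (Fin n) (Fin n) ℝ} (hQ : Q.PosDef) :
    ∃ l : ℝ, 0 < l ∧ ∀ x, l * ‖x‖ ^ 2 ≤ x ⬝ᵥ Q.mulVec x := by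
  have hc : Continuous fun x : Fin n → ℝ => x ⬝ᵥ Q.mulVec x := by
    simp only [dotProduct, Matrix.mulVec]; fun_prop
  have hpos : ∀ x : Fin n → ℝ, x ≠ 0 → 0 < x ⬝ᵥ Q.mulVec x := fun x hx => by
    simpa using hQ.dotProduct_mulVec_pos hx
  -- The unit sphere is empty only for n = 0. Otherwise l is the minimum of the form on this compact
  -- set, and homogeneity does the rest.
  obtain h | h := (Metric.sphere (0 : Fin n → ℝ) 1).eq_empty_or_nonempty
  · refine ⟨1, one_pos, fun x => ?_⟩
    have : x = 0 := by
      by_contra hx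
      have : ‖x‖⁻¹ • x ∈ Metric.sphere (0 : Fin n → ℝ) 1 := by
        simp [norm_smul, norm_ne_zero_iff.2 hx]
      simp [h] at this
    simp [this]
  · obtain ⟨y, hy, hmin⟩ := (isCompact_sphere (0 : Fin n → ℝ) 1).exists_isMinOn h hc.continuousOn
    have hy0 : y ≠ 0 := by
      rintro rfl; simp at hy
    refine ⟨_, hpos y hy0, fun x => ?_⟩
    by_cases hx : x = 0
    · simp [hx]
    · have hx' : ‖x‖ ≠ 0 := norm_ne_zero_iff.2 hx
      have : y ⬝ᵥ Q.mulVec y ≤ (‖x‖⁻¹ • x) ⬝ᵥ Q.mulVec (‖x‖⁻¹ • x) :=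
        hmin (show ‖x‖⁻¹ • x ∈ Metric.sphere (0 : Fin n → ℝ) 1 by simp [norm_smul, hx'])
      simp only [Matrix.mulVec_smul, dotProduct_smul, smul_dotProduct, smul_eq_mul] at this
      calc (y ⬝ᵥ Q.mulVec y) * ‖x‖ ^ 2
          ≤ (‖x‖⁻¹ * (‖x‖⁻¹ * (x ⬝ᵥ Q.mulVec x))) * ‖x‖ ^ 2 := by gcongr
        _ = _ := by field_simp

theorem natExponent_le {n : ℕ} {η : NatParam n} (hη : (Matrix.of η.1).PosDef) :
    ∃ a l : ℝ, 0 < l ∧ ∀ x, natExponent x η ≤ a * ‖x‖ - l * ‖x‖ ^ 2 := by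
  obtain ⟨l, hl, h⟩ := exists_le_dotProduct_mulVec hη
  refine ⟨n * ‖η.2‖, l / 2, half_pos hl, fun x => ?_⟩
  rw [natExponent_apply]
  have h1 := (le_abs_self _).trans (abs_dotProduct_le η.2 x)
  have h2 := h x
  linarith

theorem GaussTail.integrable_natExponent {n : ℕ} {ν : Measure (Fin n → ℝ)} (hν : GaussTail ν)
    {f : (Fin n → ℝ) → ℝ} (hf : ExpGrowth f) {η : NatParam n} (hη : (Matrix.of η.1).PosDef) :
    Integrable (fun x => f x * Real.exp (natExponent x η)) ν := by
  obtain ⟨a, l, hl, h⟩ := natExponent_le hη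
  exact hν.integrable hf (continuous_natExponent.clm_apply continuous_const) hl (b := 0) (a := a)
    fun x => by linarith [h x]

/-- The exponent decays quadratically at a positive definite η, and `natExponent` has at most
quadratic norm, so a small multiple of that norm can be added without losing integrability. Thus η
is interior to the domain of convergence, within all matrices and not only symmetric ones. -/
theorem GaussTail.differentiableAt {n : ℕ} {ν : Measure (Fin n → ℝ)} (hν : GaussTail ν)
    {f : (Fin n → ℝ) → ℝ} (hf : ExpGrowth f) {η : NatParam n} (hη : (Matrix.of η.1).PosDef) :
    DifferentiableAt ℝ (fun η => ∫ x, f x * Real.exp (natExponent x η) ∂ν) η := by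
  obtain ⟨a, l, hl, h⟩ := natExponent_le hη
  -- This s satisfies s n² ≤ l/2, leaving half of the decay. The summand 1 keeps the denominator
  -- positive for n = 0.
  have hs : 0 < l / (2 * (n ^ 2 + 1)) := by positivity
  refine differentiableAt_integral_mul_exp hs continuous_natExponent.aestronglyMeasurable
    hf.1.aestronglyMeasurable ?_
  refine hν.integrable hf ?_ (half_pos hl) (b := 0)
    (a := a + l / (2 * (n ^ 2 + 1)) * n) fun x => ?_
  · exact (continuous_natExponent.clm_apply continuous_const).add
      (continuous_const.mul continuous_natExponent.norm)
  · have h1 := mul_le_mul_of_nonneg_left (norm_natExponent_le x) hs.le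
    have h2 : l / (2 * (n ^ 2 + 1)) * (n ^ 2 * ‖x‖ ^ 2) ≤ l / 2 * ‖x‖ ^ 2 := by
      have : l / (2 * ((n:ℝ) ^ 2 + 1)) * n ^ 2 ≤ l / 2 := by
        rw [div_mul_eq_mul_div, div_le_div_iff₀ (by positivity) two_pos]
        nlinarith
      calc _ = (l / (2 * ((n:ℝ) ^ 2 + 1)) * n ^ 2) * ‖x‖ ^ 2 := by ring
        _ ≤ _ := by gcongr
    linarith [h x]

/-! ## The density of a nonsingular normal law -/

theorem gaussianPDF_zero_one {n : ℕ} (x : Fin n → ℝ) :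
    gaussianPDF 0 1 x = ∏ i, gaussianPDFReal 0 1 (x i) := by
  simp only [gaussianPDF, gaussianPDFReal, Finset.prod_mul_distrib, ← Real.exp_sum]
  congr 1
  · have h : √((2 * Real.pi) ^ n) = √(2 * Real.pi) ^ n := by
      rw [← Real.sqrt_sq (by positivity : 0 ≤ √(2 * Real.pi) ^ n), ← pow_mul, mul_comm n 2,
        pow_mul, Real.sq_sqrt (by positivity)]
    simp only [h, Matrix.det_one, mul_one, NNReal.coe_one, Finset.prod_const, Finset.card_univ,
      Fintype.card_fin, inv_pow]
  · congr 1
    simp [dotProduct, Finset.mul_sum]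
    rw [← Finset.sum_neg_distrib]
    exact Finset.sum_congr rfl fun i _ => by ring

theorem gaussianPDF_nonneg {n : ℕ} (μ : Fin n → ℝ) (S : Matrix (Fin n) (Fin n) ℝ)
    (x : Fin n → ℝ) : 0 ≤ gaussianPDF μ S x := by
  unfold gaussianPDF; positivity

theorem gaussianPDF_pos {n : ℕ} (μ : Fin n → ℝ) {S : Matrix (Fin n) (Fin n) ℝ} (hS : S.PosDef)
    (x : Fin n → ℝ) : 0 < gaussianPDF μ S x := by
  have := hS.det_pos
  unfold gaussianPDF; positivity

@[fun_prop]
theorem continuous_gaussianPDF {n : ℕ} (μ : Fin n → ℝ) (S : Matrix (Fin n) (Fin n) ℝ) :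
    Continuous (gaussianPDF μ S) := by
  unfold gaussianPDF
  simp only [dotProduct, Matrix.mulVec]
  fun_prop

theorem pi_gaussianReal_eq_withDensity (n : ℕ) :
    Measure.pi (fun _ : Fin n => gaussianReal 0 1) =
      volume.withDensity fun x : Fin n → ℝ => ENNReal.ofReal (gaussianPDF 0 1 x) := by
  refine Measure.pi_eq fun s hs => ?_
  rw [withDensity_apply _ (MeasurableSet.univ_pi hs), volume_pi, Measure.restrict_pi_pi,
    ← ofReal_integral_eq_lintegral_ofReal]
  · simp_rw [gaussianPDF_zero_one]
    rw [integral_fintype_prod_eq_prod (fun _ => gaussianPDFReal 0 1),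
      ENNReal.ofReal_prod_of_nonneg
        fun i _ => integral_nonneg fun x => gaussianPDFReal_nonneg 0 1 x]
    refine Finset.prod_congr rfl fun i _ => ?_
    rw [gaussianReal_apply_eq_integral 0 one_ne_zero]
  · rw [show gaussianPDF (0 : Fin n → ℝ) 1 = _ from funext gaussianPDF_zero_one]
    exact Integrable.fintype_prod (f := fun _ => gaussianPDFReal 0 1)
      fun i => (integrable_gaussianPDFReal 0 1).restrict
  · exact Filter.Eventually.of_forall fun x => gaussianPDF_nonneg _ _ x

theorem map_withDensity_comp {α β : Type*} [MeasurableSpace α] [MeasurableSpace β]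
    {ν : Measure α} {T : α → β} (hT : Measurable T) {ψ : β → ENNReal} (hψ : Measurable ψ) :
    (ν.withDensity (ψ ∘ T)).map T = (ν.map T).withDensity ψ := by
  ext s hs
  rw [Measure.map_apply hT hs, withDensity_apply _ (hT hs), withDensity_apply _ hs,
    setLIntegral_map hs hψ hT]
  rfl

open scoped MatrixOrder in
theorem gaussian_eq_map_pi {n : ℕ} (μ : Fin n → ℝ) (S : Matrix (Fin n) (Fin n) ℝ) :
    gaussian μ S = (Measure.pi (fun _ : Fin n => gaussianReal 0 1)).map
      fun x => μ + (CFC.sqrt S).mulVec x := by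
  unfold gaussian multivariateGaussian
  rw [← map_pi_eq_stdGaussian, Measure.map_map (by fun_prop) (by fun_prop),
    Measure.map_map (by fun_prop) (by fun_prop)]
  rfl

-- Change of variables x = μ + Rz with R the symmetric square root of S: the quadratic form becomes
-- z ⬝ z, and det S = (det R)² makes the Jacobian match the normalizing constant.
open scoped MatrixOrder in
theorem gaussian_eq_withDensity {n : ℕ} (μ : Fin n → ℝ) {S : Matrix (Fin n) (Fin n) ℝ}
    (hS : S.PosDef) :
    gaussian μ S = volume.withDensity fun x => ENNReal.ofReal (gaussianPDF μ S x) := by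
  set R := CFC.sqrt S with hR
  have hRR : R * R = S := CFC.sqrt_mul_sqrt_self S hS.posSemidef.nonneg
  have hRt : R.transpose = R := by
    have h : R.PosSemidef := Matrix.nonneg_iff_posSemidef.1 (CFC.sqrt_nonneg S)
    simpa using h.isHermitian.eq
  have hdet : S.det = R.det ^ 2 := by rw [← hRR, Matrix.det_mul, sq]
  have hR0 : R.det ≠ 0 := by
    intro h; have := hS.det_pos; simp [hdet, h] at this
  have hU : IsUnit R.det := isUnit_iff_ne_zero.2 hR0
  have hquad : ∀ z : Fin n → ℝ, (R.mulVec z) ⬝ᵥ (S⁻¹).mulVec (R.mulVec z) = z ⬝ᵥ z := by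
    intro z
    rw [Matrix.mulVec_mulVec, ← hRR, Matrix.mul_inv_rev, Matrix.mul_assoc,
      Matrix.nonsing_inv_mul _ hU, Matrix.mul_one, dotProduct_comm, Matrix.dotProduct_mulVec,
      Matrix.vecMul_mulVec, Matrix.transpose_nonsing_inv, hRt, ← Matrix.mulVec_transpose]
    simp [Matrix.nonsing_inv_mul _ hU]
  have hpdf : ∀ z : Fin n → ℝ,
      gaussianPDF 0 1 z = |R.det| * gaussianPDF μ S (μ + R.mulVec z) := by
    intro z
    have h0 : 0 < |R.det| := abs_pos.2 hR0
    simp only [gaussianPDF, add_sub_cancel_left, hquad, hdet, sub_zero, inv_one,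
      Matrix.one_mulVec, Matrix.det_one, mul_one]
    rw [Real.sqrt_mul (by positivity), Real.sqrt_sq_eq_abs]
    field_simp
  have hT : Measurable fun x : Fin n → ℝ => μ + R.mulVec x := by
    exact (Continuous.const_add (by fun_prop) μ).measurable
  have hvol : (volume : Measure (Fin n → ℝ)).map (fun x => μ + R.mulVec x) =
      ENNReal.ofReal |R.det|⁻¹ • volume := by
    have h1 := Measure.map_linearMap_addHaar_pi_eq_smul_addHaar (f := Matrix.toLin' R)
      (by rwa [LinearMap.det_toLin']) volume
    have h2 : (fun x : Fin n → ℝ => μ + R.mulVec x) = (fun x => μ + x) ∘ (Matrix.toLin' R) := by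
      ext x; simp
    rw [h2, ← Measure.map_map (by fun_prop) (LinearMap.continuous_of_finiteDimensional _).measurable,
      h1, Measure.map_smul, map_add_left_eq_self, LinearMap.det_toLin', abs_inv]
  rw [gaussian_eq_map_pi, pi_gaussianReal_eq_withDensity, ← hR]
  have hcomp : (fun x : Fin n → ℝ => ENNReal.ofReal (gaussianPDF 0 1 x)) =
      (fun y => ENNReal.ofReal (|R.det| * gaussianPDF μ S y)) ∘ fun x => μ + R.mulVec x := by
    ext x; simp only [Function.comp_apply, hpdf x]
  have hm : Measurable fun y => ENNReal.ofReal (|R.det| * gaussianPDF μ S y) := by fun_prop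
  rw [hcomp, map_withDensity_comp hT hm, hvol, withDensity_smul_measure, ← withDensity_smul _ hm]
  congr 1
  ext y
  rw [Pi.smul_apply, smul_eq_mul, ← ENNReal.ofReal_mul (by positivity), ← mul_assoc,
    inv_mul_cancel₀ (abs_pos.2 hR0).ne', one_mul]

instance {n : ℕ} (μ : Fin n → ℝ) (S : Matrix (Fin n) (Fin n) ℝ) :
    IsProbabilityMeasure (gaussian μ S) :=
  Measure.isProbabilityMeasure_map (Measurable.aemeasurable (by fun_prop))

/-! ## Measures with Gaussian tails -/

/-- For the sup norm, ∑ xᵢ² is at most (number of coordinates) · ‖x‖², so a product of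
one-dimensional Gaussians dominates; the rate is divided by the number of coordinates plus one,
which is never zero. -/
theorem integrable_exp_neg_sq_norm {ι : Type*} [Fintype ι] {l : ℝ} (hl : 0 < l) :
    Integrable (fun x : ι → ℝ => Real.exp (-(l * ‖x‖ ^ 2))) := by
  have hN : (0 : ℝ) < Fintype.card ι + 1 := by positivity
  have h : Integrable (fun x : ι → ℝ =>
      ∏ i, Real.exp (-(l / (Fintype.card ι + 1)) * x i ^ 2)) volume :=
    Integrable.fintype_prod (f := fun _ t => Real.exp (-(l / (Fintype.card ι + 1)) * t ^ 2))
      fun i => integrable_exp_neg_mul_sq (by positivity)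
  refine h.mono (Continuous.aestronglyMeasurable (by fun_prop))
    (Filter.Eventually.of_forall fun x => ?_)
  rw [← Real.exp_sum, Real.norm_of_nonneg (Real.exp_pos _).le,
    Real.norm_of_nonneg (Real.exp_pos _).le, ← Finset.mul_sum]
  gcongr
  have h1 : ∑ i, x i ^ 2 ≤ (Fintype.card ι + 1) * ‖x‖ ^ 2 := by
    calc ∑ i, x i ^ 2 ≤ ∑ _i : ι, ‖x‖ ^ 2 := by
          refine Finset.sum_le_sum fun i _ => ?_
          rw [← sq_abs, ← Real.norm_eq_abs]
          exact pow_le_pow_left₀ (norm_nonneg _) (norm_le_pi_norm x i) 2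
      _ = Fintype.card ι * ‖x‖ ^ 2 := by simp
      _ ≤ _ := by gcongr; linarith
  have h2 : l / (Fintype.card ι + 1) * ∑ i, x i ^ 2 ≤ l * ‖x‖ ^ 2 := by
    rw [div_mul_eq_mul_div, div_le_iff₀ hN]
    nlinarith
  linarith

theorem gaussTail_volume {n : ℕ} : GaussTail (volume : Measure (Fin n → ℝ)) :=
  fun _ hl => integrable_exp_neg_sq_norm hl

theorem GaussTail.restrict {n : ℕ} {ν : Measure (Fin n → ℝ)} (hν : GaussTail ν)
    (s : Set (Fin n → ℝ)) : GaussTail (ν.restrict s) :=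
  fun l hl => (hν l hl).restrict

/-- With a Dirac base measure, the value of a density at a point is an integral covered by the
general differentiability result. -/
theorem gaussTail_dirac {n : ℕ} (x : Fin n → ℝ) : GaussTail (Measure.dirac x) :=
  fun _ _ => integrable_dirac (by simp)

@[fun_prop]
theorem continuous_glue {n : ℕ} (ξ : Fin n) :
    Continuous fun q : ({j : Fin n // j ≠ ξ} → ℝ) × ℝ => glue ξ q.1 q.2 := by
  refine continuous_pi fun j => ?_
  unfold glue
  split_ifs <;> fun_prop

@[fun_prop]
theorem continuous_glue_left {n : ℕ} (ξ : Fin n) (c : ℝ) :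
    Continuous fun y : {j : Fin n // j ≠ ξ} → ℝ => glue ξ y c :=
  (continuous_glue ξ).comp (by fun_prop : Continuous fun y => (y, c))

theorem gaussTail_map_glue {n : ℕ} (ξ : Fin n) :
    GaussTail ((volume : Measure ({j : Fin n // j ≠ ξ} → ℝ)).map fun y => glue ξ y 0) := by
  intro l hl
  rw [integrable_map_measure (Continuous.aestronglyMeasurable (by fun_prop))
    (continuous_glue_left ξ 0).aemeasurable]
  refine (integrable_exp_neg_sq_norm hl).mono
    (Continuous.aestronglyMeasurable (by fun_prop)) (Filter.Eventually.of_forall fun y => ?_)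
  rw [Function.comp_apply, Real.norm_of_nonneg (Real.exp_pos _).le,
    Real.norm_of_nonneg (Real.exp_pos _).le]
  have : ‖y‖ ≤ ‖glue ξ y 0‖ := by
    refine (pi_norm_le_iff_of_nonneg (norm_nonneg _)).2 fun j => ?_
    have := norm_le_pi_norm (glue ξ y 0) j
    simpa [glue, j.2] using this
  gcongr

/-! ## Differentiability of Gaussian integrals -/

section Diff

variable {E : Type*} [NormedAddCommGroup E] [NormedSpace ℝ E] {S : Set E} {n : ℕ}

theorem differentiableOn_det {ι : Type*} [Fintype ι] [DecidableEq ι] {C : E → Matrix ι ι ℝ}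
    (hC : ∀ i j, DifferentiableOn ℝ (fun Θ => C Θ i j) S) :
    DifferentiableOn ℝ (fun Θ => (C Θ).det) S := by
  simp only [Matrix.det_apply]
  refine DifferentiableOn.fun_sum fun σ _ => DifferentiableOn.const_smul ?_ _
  have h : ∀ s : Finset ι, DifferentiableOn ℝ (fun Θ => ∏ i ∈ s, C Θ (σ i) i) S := by
    intro s
    induction s using Finset.induction_on with
    | empty => simp
    | insert i s hi ih =>
      simp only [Finset.prod_insert hi]
      exact (hC _ _).mul ih
  exact h _

/-- Cramer's rule: an entry of the inverse is a determinant of a matrix with one row replaced by a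
constant one, divided by the determinant. -/
theorem differentiableOn_inv_apply {ι : Type*} [Fintype ι] [DecidableEq ι] {C : E → Matrix ι ι ℝ}
    (hC : ∀ i j, DifferentiableOn ℝ (fun Θ => C Θ i j) S) (h0 : ∀ Θ ∈ S, (C Θ).det ≠ 0)
    (i j : ι) : DifferentiableOn ℝ (fun Θ => (C Θ)⁻¹ i j) S := by
  simp only [Matrix.inv_def, Ring.inverse_eq_inv', Matrix.smul_apply, smul_eq_mul,
    Matrix.adjugate_apply]
  refine ((differentiableOn_det hC).inv h0).mul (differentiableOn_det fun k l => ?_)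
  by_cases hk : k = j
  · subst hk
    simp
  · simpa [Matrix.updateRow_ne hk] using hC k l

variable {μ : E → Fin n → ℝ} {C : E → Matrix (Fin n) (Fin n) ℝ}

/-- The natural parameters of the normal law with mean `m` and covariance matrix `A`. -/
def natParam {n : ℕ} (m : Fin n → ℝ) (A : Matrix (Fin n) (Fin n) ℝ) : NatParam n :=
  (fun i j => (A⁻¹ : Matrix (Fin n) (Fin n) ℝ) i j, (A⁻¹).mulVec m)

/-- Expand the square; the symmetry of A⁻¹ merges the two cross terms into the linear part of the
exponent. -/
theorem gaussianPDF_eq_natExponent (m : Fin n → ℝ) {A : Matrix (Fin n) (Fin n) ℝ}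
    (hA : A.PosDef) (x : Fin n → ℝ) :
    gaussianPDF m A x = (√((2 * Real.pi) ^ n * A.det))⁻¹ *
      Real.exp (-(1 / 2) * (m ⬝ᵥ (A⁻¹).mulVec m)) *
        Real.exp (natExponent x (natParam m A)) := by
  rw [gaussianPDF, mul_assoc, ← Real.exp_add, natExponent_apply]
  congr 2
  have hs : (A⁻¹).transpose = A⁻¹ := by simpa using hA.inv.isHermitian.eq
  have h1 : m ⬝ᵥ (A⁻¹).mulVec x = (A⁻¹).mulVec m ⬝ᵥ x := by
    rw [Matrix.dotProduct_mulVec, ← Matrix.mulVec_transpose, hs]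
  have h2 : x ⬝ᵥ (A⁻¹).mulVec m = (A⁻¹).mulVec m ⬝ᵥ x := dotProduct_comm _ _
  rw [Matrix.mulVec_sub, dotProduct_sub, sub_dotProduct, sub_dotProduct, h1, h2]
  change _ = _ + ((A⁻¹).mulVec m ⬝ᵥ x - 1 / 2 * (x ⬝ᵥ (A⁻¹).mulVec x))
  ring

/-- The chain rule through the natural parameters. The outer function is differentiable on a full
neighbourhood in parameter space, so S may be an arbitrary set. -/
theorem differentiableOn_integral_mul_gaussianPDF {ν : Measure (Fin n → ℝ)} (hν : GaussTail ν)
    {f : (Fin n → ℝ) → ℝ} (hf : ExpGrowth f)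
    (hμ : ∀ i, DifferentiableOn ℝ (fun Θ => μ Θ i) S)
    (hC : ∀ i j, DifferentiableOn ℝ (fun Θ => C Θ i j) S) (hpos : ∀ Θ ∈ S, (C Θ).PosDef) :
    DifferentiableOn ℝ (fun Θ => ∫ x, f x * gaussianPDF (μ Θ) (C Θ) x ∂ν) S := by
  have hinv := differentiableOn_inv_apply hC fun Θ hΘ => (hpos Θ hΘ).det_pos.ne'
  have hQμ : ∀ i, DifferentiableOn ℝ (fun Θ => ((C Θ)⁻¹.mulVec (μ Θ)) i) S := fun i => by
    simp only [Matrix.mulVec, dotProduct]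
    exact DifferentiableOn.fun_sum fun j _ => (hinv i j).mul (hμ j)
  have hquad : DifferentiableOn ℝ (fun Θ => μ Θ ⬝ᵥ (C Θ)⁻¹.mulVec (μ Θ)) S := by
    simp only [dotProduct]
    exact DifferentiableOn.fun_sum fun i _ => (hμ i).mul (hQμ i)
  have hη : DifferentiableOn ℝ
      (fun Θ => (natParam (μ Θ) (C Θ))) S := by
    refine DifferentiableOn.prodMk ?_ (differentiableOn_pi.2 hQμ)
    exact differentiableOn_pi.2 fun i => differentiableOn_pi.2 fun j => hinv i j
  have hI : DifferentiableOn ℝ (fun Θ => ∫ x, f x *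
      Real.exp (natExponent x (natParam (μ Θ) (C Θ))) ∂ν) S :=
    fun Θ hΘ => DifferentiableAt.comp_differentiableWithinAt
      (g := fun η : NatParam n => ∫ x, f x * Real.exp (natExponent x η) ∂ν) Θ
      (hν.differentiableAt hf (η := natParam (μ Θ) (C Θ)) (hpos Θ hΘ).inv) (hη Θ hΘ)
  have hc : DifferentiableOn ℝ (fun Θ => (√((2 * Real.pi) ^ n * (C Θ).det))⁻¹ *
      Real.exp (-(1 / 2) * (μ Θ ⬝ᵥ (C Θ)⁻¹.mulVec (μ Θ)))) S := by
    have hd : ∀ Θ ∈ S, (2 * Real.pi) ^ n * (C Θ).det ≠ 0 := fun Θ hΘ => by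
      have := (hpos Θ hΘ).det_pos
      positivity
    refine DifferentiableOn.mul (DifferentiableOn.inv ?_ fun Θ hΘ => ?_) ?_
    · exact ((differentiableOn_det hC).const_mul _).sqrt hd
    · have := (hpos Θ hΘ).det_pos
      positivity
    · exact (hquad.const_mul _).exp
  refine (hc.mul hI).congr fun Θ hΘ => ?_
  simp only [Pi.mul_apply]
  rw [← integral_const_mul]
  congr 1
  ext x
  rw [gaussianPDF_eq_natExponent _ (hpos Θ hΘ)]
  ring

theorem differentiableOn_gaussianPDF
    (hμ : ∀ i, DifferentiableOn ℝ (fun Θ => μ Θ i) S)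
    (hC : ∀ i j, DifferentiableOn ℝ (fun Θ => C Θ i j) S) (hpos : ∀ Θ ∈ S, (C Θ).PosDef)
    (x : Fin n → ℝ) : DifferentiableOn ℝ (fun Θ => gaussianPDF (μ Θ) (C Θ) x) S := by
  simpa using differentiableOn_integral_mul_gaussianPDF (gaussTail_dirac x) (.const 1) hμ hC hpos

end Diff

theorem GaussTail.integrable_mul_gaussianPDF {n : ℕ} {ν : Measure (Fin n → ℝ)} (hν : GaussTail ν)
    {f : (Fin n → ℝ) → ℝ} (hf : ExpGrowth f) (μ : Fin n → ℝ) {C : Matrix (Fin n) (Fin n) ℝ}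
    (hC : C.PosDef) : Integrable (fun x => f x * gaussianPDF μ C x) ν := by
  have h := (hν.integrable_natExponent hf
    (η := natParam μ C) hC.inv).const_mul
    ((√((2 * Real.pi) ^ n * C.det))⁻¹ * Real.exp (-(1 / 2) * (μ ⬝ᵥ (C⁻¹).mulVec μ)))
  refine h.congr (Filter.Eventually.of_forall fun x => ?_)
  simp only [gaussianPDF_eq_natExponent _ hC]
  ring

/-! ## Normalized Gaussian densities with respect to a base measure -/

/-- The probability measure with density proportional to `gaussianPDF μ C` with respect to `ν`. -/
def tiltLaw {n : ℕ} (ν : Measure (Fin n → ℝ)) (μ : Fin n → ℝ) (C : Matrix (Fin n) (Fin n) ℝ) :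
    Measure (Fin n → ℝ) :=
  ν.withDensity fun x => ENNReal.ofReal (gaussianPDF μ C x / ∫ y, gaussianPDF μ C y ∂ν)

section TiltLaw

variable {n : ℕ} {ν : Measure (Fin n → ℝ)} {μ : Fin n → ℝ} {C : Matrix (Fin n) (Fin n) ℝ}

theorem GaussTail.integrable_gaussianPDF (hν : GaussTail ν) (μ : Fin n → ℝ) (hC : C.PosDef) :
    Integrable (gaussianPDF μ C) ν := by
  simpa using hν.integrable_mul_gaussianPDF (.const 1) μ hC

theorem GaussTail.integral_gaussianPDF_pos (hν : GaussTail ν) (h0 : ν ≠ 0) (μ : Fin n → ℝ)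
    (hC : C.PosDef) : 0 < ∫ x, gaussianPDF μ C x ∂ν := by
  rw [integral_pos_iff_support_of_nonneg (gaussianPDF_nonneg μ C)
    (hν.integrable_gaussianPDF μ hC)]
  have : Function.support (gaussianPDF μ C) = Set.univ :=
    Set.eq_univ_of_forall fun x => (gaussianPDF_pos μ hC x).ne'
  rw [this]
  exact (Measure.measure_univ_pos).2 h0

theorem integral_tiltLaw (f : (Fin n → ℝ) → ℝ) :
    ∫ x, f x ∂(tiltLaw ν μ C) =
      (∫ x, f x * gaussianPDF μ C x ∂ν) / ∫ x, gaussianPDF μ C x ∂ν := by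
  have h0 : 0 ≤ ∫ x, gaussianPDF μ C x ∂ν := integral_nonneg (gaussianPDF_nonneg μ C)
  rw [tiltLaw, integral_withDensity_eq_integral_toReal_smul (by fun_prop)
    (Filter.Eventually.of_forall fun _ => ENNReal.ofReal_lt_top), ← integral_div]
  congr 1
  ext x
  rw [ENNReal.toReal_ofReal (div_nonneg (gaussianPDF_nonneg μ C x) h0), smul_eq_mul]
  ring

theorem integrable_tiltLaw (hν : GaussTail ν) (hC : C.PosDef) {f : (Fin n → ℝ) → ℝ}
    (hf : ExpGrowth f) : Integrable f (tiltLaw ν μ C) := by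
  have h0 : 0 ≤ ∫ x, gaussianPDF μ C x ∂ν := integral_nonneg (gaussianPDF_nonneg μ C)
  rw [tiltLaw, integrable_withDensity_iff_integrable_smul' (by fun_prop)
    (Filter.Eventually.of_forall fun _ => ENNReal.ofReal_lt_top)]
  refine ((hν.integrable_mul_gaussianPDF hf μ hC).div_const
    (∫ x, gaussianPDF μ C x ∂ν)).congr (Filter.Eventually.of_forall fun x => ?_)
  simp only
  rw [ENNReal.toReal_ofReal (div_nonneg (gaussianPDF_nonneg μ C x) h0), smul_eq_mul]
  ring

theorem memLp_tiltLaw (hν : GaussTail ν) (hC : C.PosDef) {f : (Fin n → ℝ) → ℝ}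
    (hf : ExpGrowth f) : MemLp f 2 (tiltLaw ν μ C) := by
  rw [memLp_two_iff_integrable_sq hf.1.aestronglyMeasurable]
  simpa only [sq] using integrable_tiltLaw hν hC (hf.mul hf)

theorem isProbabilityMeasure_tiltLaw (hν : GaussTail ν) (h0 : ν ≠ 0) (hC : C.PosDef) :
    IsProbabilityMeasure (tiltLaw ν μ C) := by
  constructor
  have hp := hν.integral_gaussianPDF_pos h0 μ hC
  rw [tiltLaw, withDensity_apply _ MeasurableSet.univ, Measure.restrict_univ,
    ← ofReal_integral_eq_lintegral_ofReal ((hν.integrable_gaussianPDF μ hC).div_const _)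
      (Filter.Eventually.of_forall fun x => div_nonneg (gaussianPDF_nonneg μ C x) hp.le),
    integral_div, div_self hp.ne', ENNReal.ofReal_one]

theorem gaussian_real_eq_integral (μ : Fin n → ℝ) (hC : C.PosDef) {A : Set (Fin n → ℝ)}
    (hA : MeasurableSet A) : (gaussian μ C).real A = ∫ x in A, gaussianPDF μ C x := by
  rw [measureReal_def, gaussian_eq_withDensity μ hC, withDensity_apply _ hA,
    ← ofReal_integral_eq_lintegral_ofReal
      ((gaussTail_volume.restrict A).integrable_gaussianPDF μ hC)
      (Filter.Eventually.of_forall fun x => gaussianPDF_nonneg μ C x),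
    ENNReal.toReal_ofReal (integral_nonneg fun x => gaussianPDF_nonneg μ C x)]

theorem integral_gaussianPDF (μ : Fin n → ℝ) (hC : C.PosDef) :
    ∫ x, gaussianPDF μ C x = 1 := by
  have h := gaussian_real_eq_integral μ hC MeasurableSet.univ
  simpa using h.symm

theorem gaussian_eq_tiltLaw (μ : Fin n → ℝ) (hC : C.PosDef) :
    gaussian μ C = tiltLaw volume μ C := by
  rw [tiltLaw, integral_gaussianPDF μ hC, gaussian_eq_withDensity μ hC]
  simp

theorem cond_gaussian_eq_tiltLaw (μ : Fin n → ℝ) (hC : C.PosDef) {A : Set (Fin n → ℝ)}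
    (hA : MeasurableSet A) (h0 : volume A ≠ 0) :
    cond (gaussian μ C) A = tiltLaw (volume.restrict A) μ C := by
  have hp : 0 < ∫ x in A, gaussianPDF μ C x :=
    (gaussTail_volume.restrict A).integral_gaussianPDF_pos
      (by rwa [Ne, Measure.restrict_eq_zero]) μ hC
  have hA' : (gaussian μ C) A = ENNReal.ofReal (∫ x in A, gaussianPDF μ C x) := by
    rw [← gaussian_real_eq_integral μ hC hA, ofReal_measureReal]
  rw [ProbabilityTheory.cond, hA', gaussian_eq_withDensity μ hC, restrict_withDensity hA, tiltLaw,
    ← withDensity_smul _ (by fun_prop)]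
  congr 1
  ext x
  rw [Pi.smul_apply, smul_eq_mul, ENNReal.ofReal_div_of_pos hp, ENNReal.div_eq_inv_mul]

theorem volume_absolutelyContinuous_gaussian (μ : Fin n → ℝ) (hC : C.PosDef) :
    volume ≪ gaussian μ C := by
  rw [gaussian_eq_withDensity μ hC]
  exact withDensity_absolutelyContinuous' (by fun_prop)
    (Filter.Eventually.of_forall fun x => by
      simpa using gaussianPDF_pos μ hC x)

theorem gaussian_absolutelyContinuous_volume (μ : Fin n → ℝ) (hC : C.PosDef) :
    gaussian μ C ≪ volume := by
  rw [gaussian_eq_withDensity μ hC]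
  exact withDensity_absolutelyContinuous _ _

theorem isOpenPosMeasure_gaussian (μ : Fin n → ℝ) (hC : C.PosDef) :
    (gaussian μ C).IsOpenPosMeasure :=
  (volume_absolutelyContinuous_gaussian μ hC).isOpenPosMeasure

theorem gaussian_map_add (μ u : Fin n → ℝ) :
    (gaussian (μ - u) C).map (fun x => x + u) = gaussian μ C := by
  rw [gaussian_eq_map_pi, gaussian_eq_map_pi, Measure.map_map (by fun_prop)]
  · congr 1
    ext x i
    simp only [Function.comp_apply, Pi.add_apply, Pi.sub_apply]
    ring
  · exact (Continuous.const_add (by fun_prop) _).measurable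

end TiltLaw

/-! ## Families of random vectors with differentiable first and second moments -/

/-- The random vectors `Y Θ` under `P Θ` have means and covariances that are differentiable
in `Θ ∈ S`. -/
structure DiffMoments {E Ω κ : Type*} [NormedAddCommGroup E] [NormedSpace ℝ E]
    [MeasurableSpace Ω] (S : Set E) (P : E → Measure Ω) (Y : E → κ → Ω → ℝ) : Prop where
  prob : ∀ Θ ∈ S, IsProbabilityMeasure (P Θ)
  memLp : ∀ Θ ∈ S, ∀ i, MemLp (Y Θ i) 2 (P Θ)
  mean : ∀ i, DifferentiableOn ℝ (fun Θ => ∫ ω, Y Θ i ω ∂(P Θ)) S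
  cov : ∀ i j, DifferentiableOn ℝ (fun Θ => cov[Y Θ i, Y Θ j; P Θ]) S

section DiffMoments

variable {E Ω κ κ' : Type*} [NormedAddCommGroup E] [NormedSpace ℝ E] [MeasurableSpace Ω]
  {S : Set E} {P : E → Measure Ω} {Y : E → κ → Ω → ℝ} {n : ℕ}

/-- Means and covariances of an affine image are polynomials in the coefficients and the old
moments. -/
theorem DiffMoments.affine [Fintype κ] (h : DiffMoments S P Y) {M : E → κ' → κ → ℝ}
    {v : E → κ' → ℝ} (hM : ∀ i k, DifferentiableOn ℝ (fun Θ => M Θ i k) S)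
    (hv : ∀ i, DifferentiableOn ℝ (fun Θ => v Θ i) S) :
    DiffMoments S P fun Θ i ω => ∑ k, M Θ i k * Y Θ k ω + v Θ i := by
  have hL : ∀ Θ ∈ S, ∀ i, MemLp (fun ω => ∑ k, M Θ i k * Y Θ k ω) 2 (P Θ) := fun Θ hΘ i =>
    memLp_finsetSum _ fun k _ => (h.memLp Θ hΘ k).const_mul _
  refine ⟨h.prob, fun Θ hΘ i => ?_, fun i => ?_, fun i j => ?_⟩
  · have := h.prob Θ hΘ
    exact (hL Θ hΘ i).add (memLp_const _)
  · refine ((DifferentiableOn.fun_sum fun k _ => (hM i k).mul (h.mean k) :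
      DifferentiableOn ℝ (fun Θ => ∑ k, M Θ i k * ∫ ω, Y Θ k ω ∂(P Θ)) S).add (hv i)).congr
      fun Θ hΘ => ?_
    have := h.prob Θ hΘ
    have hi : ∀ k, Integrable (fun ω => M Θ i k * Y Θ k ω) (P Θ) := fun k =>
      ((h.memLp Θ hΘ k).integrable (by norm_num)).const_mul _
    simp only [Pi.add_apply]
    rw [integral_add (integrable_finsetSum _ fun k _ => hi k) (integrable_const _),
      integral_finsetSum _ fun k _ => hi k]
    simp [integral_const_mul]
  · refine (DifferentiableOn.fun_sum fun k _ => DifferentiableOn.fun_sum fun l _ =>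
      ((hM i k).mul (hM j l)).mul (h.cov k l) :
      DifferentiableOn ℝ (fun Θ => ∑ k, ∑ l, M Θ i k * M Θ j l * cov[Y Θ k, Y Θ l; P Θ]) S).congr
      fun Θ hΘ => ?_
    have := h.prob Θ hΘ
    rw [covariance_add_const_left ((hL Θ hΘ i).integrable (by norm_num)),
      covariance_add_const_right ((hL Θ hΘ j).integrable (by norm_num)),
      covariance_fun_sum_fun_sum (fun k => (h.memLp Θ hΘ k).const_mul _)
        (fun k => (h.memLp Θ hΘ k).const_mul _)]
    refine Finset.sum_congr rfl fun k _ => Finset.sum_congr rfl fun l _ => ?_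
    rw [covariance_const_mul_left, covariance_const_mul_right]
    ring

theorem DiffMoments.congr {Y' : E → κ → Ω → ℝ} (h : DiffMoments S P Y)
    (hY : ∀ Θ i ω, Y' Θ i ω = Y Θ i ω) : DiffMoments S P Y' := by
  have : Y' = Y := by ext; apply hY
  rwa [this]

theorem DiffMoments.congr_measure {P' : E → Measure Ω} (h : DiffMoments S P Y)
    (hP : ∀ Θ ∈ S, P' Θ = P Θ) : DiffMoments S P' Y := by
  refine ⟨fun Θ hΘ => ?_, fun Θ hΘ => ?_, fun i => ?_, fun i j => ?_⟩
  · rw [hP Θ hΘ]; exact h.prob Θ hΘ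
  · rw [hP Θ hΘ]; exact h.memLp Θ hΘ
  · exact (h.mean i).congr fun Θ hΘ => by rw [hP Θ hΘ]
  · exact (h.cov i j).congr fun Θ hΘ => by rw [hP Θ hΘ]

/-- The law of a family of random vectors with differentiable moments. -/
theorem DiffMoments.map {φ : E → Ω → Fin n → ℝ} (hφ : ∀ Θ ∈ S, Measurable (φ Θ))
    (h : DiffMoments S P fun Θ i ω => φ Θ ω i) :
    DiffMoments S (fun Θ => (P Θ).map (φ Θ)) fun _ i x => x i := by
  have hm : ∀ (i : Fin n) (Q : Measure (Fin n → ℝ)),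
      AEStronglyMeasurable (fun x : Fin n → ℝ => x i) Q :=
    fun i Q => (measurable_pi_apply i).aestronglyMeasurable
  refine ⟨fun Θ hΘ => ?_, fun Θ hΘ i => ?_, fun i => ?_, fun i j => ?_⟩
  · have := h.prob Θ hΘ
    exact Measure.isProbabilityMeasure_map (hφ Θ hΘ).aemeasurable
  · rw [memLp_map_measure_iff (hm _ _) (hφ Θ hΘ).aemeasurable]
    exact h.memLp Θ hΘ i
  · exact (h.mean i).congr fun Θ hΘ => integral_map (hφ Θ hΘ).aemeasurable (hm _ _)
  · exact (h.cov i j).congr fun Θ hΘ => covariance_map (hm _ _) (hm _ _) (hφ Θ hΘ).aemeasurable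

theorem normal_eq (m s : ℝ) : normal m s = gaussianReal m (s ^ 2).toNNReal := by
  unfold normal
  congr 1
  exact NNReal.eq (Real.coe_toNNReal _ (sq_nonneg s)).symm

theorem integral_id_normal (m s : ℝ) : ∫ x, x ∂(normal m s) = m := by
  rw [normal_eq, integral_id_gaussianReal]

theorem memLp_id_normal (m s : ℝ) : MemLp (fun x => x) 2 (normal m s) := by
  rw [normal_eq]
  exact memLp_id_gaussianReal 2

instance (m s : ℝ) : IsProbabilityMeasure (normal m s) := by
  rw [normal_eq]; infer_instance

/-- Adjoining an independent normal variable. -/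
theorem DiffMoments.prod_normal (h : DiffMoments S P Y) {m s : E → ℝ}
    (hm : DifferentiableOn ℝ m S) (hs : DifferentiableOn ℝ s S) :
    DiffMoments S (fun Θ => (P Θ).prod (normal (m Θ) (s Θ)))
      fun Θ (i : Option κ) (q : Ω × ℝ) => i.elim q.2 fun k => Y Θ k q.1 := by
  refine ⟨fun Θ hΘ => ?_, fun Θ hΘ i => ?_, fun i => ?_, fun i j => ?_⟩
  · have := h.prob Θ hΘ
    infer_instance
  · have := h.prob Θ hΘ
    cases i with
    | none => exact (memLp_id_normal _ _).comp_snd _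
    | some k => exact (h.memLp Θ hΘ k).comp_fst _
  · cases i with
    | none =>
      refine hm.congr fun Θ hΘ => ?_
      have := h.prob Θ hΘ
      simpa [integral_id_normal] using
        integral_fun_snd (μ := P Θ) (ν := normal (m Θ) (s Θ)) (fun x : ℝ => x)
    | some k =>
      refine (h.mean k).congr fun Θ hΘ => ?_
      have := h.prob Θ hΘ
      simpa using integral_fun_fst (μ := P Θ) (ν := normal (m Θ) (s Θ)) (Y Θ k)
  · have hcross : ∀ Θ ∈ S, ∀ k, cov[fun q => Y Θ k q.1, fun q => q.2;
        (P Θ).prod (normal (m Θ) (s Θ))] = 0 := fun Θ hΘ k => by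
      have := h.prob Θ hΘ
      exact covariance_fst_snd_prod (h.memLp Θ hΘ k) (memLp_id_normal _ _)
    -- The index `none` is the adjoined variable. The covariance matrix is block diagonal, with s²
    -- in the new block.
    rcases i with _ | k <;> rcases j with _ | l
    · refine (hs.pow 2).congr fun Θ hΘ => ?_
      have := h.prob Θ hΘ
      have h1 := covariance_map_fun (μ := (P Θ).prod (normal (m Θ) (s Θ))) (Z := Prod.snd)
        (X := fun x : ℝ => x) (Y := fun x => x) (by fun_prop) (by fun_prop) (by fun_prop)
      change cov[fun q : Ω × ℝ => q.2, fun q => q.2; _] = _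
      rw [← h1, ← Measure.snd, Measure.snd_prod, covariance_self (by fun_prop), normal_eq]
      exact variance_id_gaussianReal.trans (Real.coe_toNNReal _ (sq_nonneg _))
    · refine (differentiableOn_const 0).congr fun Θ hΘ => ?_
      rw [covariance_comm]
      exact hcross Θ hΘ l
    · exact (differentiableOn_const 0).congr fun Θ hΘ => hcross Θ hΘ k
    · refine (h.cov k l).congr fun Θ hΘ => ?_
      have := h.prob Θ hΘ
      have hk := (h.memLp Θ hΘ k).aestronglyMeasurable
      have hl := (h.memLp Θ hΘ l).aestronglyMeasurable
      have hf : ((P Θ).prod (normal (m Θ) (s Θ))).map Prod.fst = P Θ := by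
        rw [← Measure.fst, Measure.fst_prod]
      have h1 := covariance_map_fun (μ := (P Θ).prod (normal (m Θ) (s Θ))) (Z := Prod.fst)
        (X := Y Θ k) (Y := Y Θ l) (by rwa [hf]) (by rwa [hf]) (by fun_prop)
      change cov[fun q : Ω × ℝ => Y Θ k q.1, fun q => Y Θ l q.1; _] = _
      rw [← h1, hf]

/-- Each moment is a quotient of two differentiable integrals. The denominator is positive because
the density is positive everywhere and ν is nonzero. -/
theorem diffMoments_tiltLaw {ν : Measure (Fin n → ℝ)} (hν : GaussTail ν) (h0 : ν ≠ 0)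
    {μ : E → Fin n → ℝ} {C : E → Matrix (Fin n) (Fin n) ℝ}
    (hμ : ∀ i, DifferentiableOn ℝ (fun Θ => μ Θ i) S)
    (hC : ∀ i j, DifferentiableOn ℝ (fun Θ => C Θ i j) S) (hpos : ∀ Θ ∈ S, (C Θ).PosDef)
    {φ : κ → (Fin n → ℝ) → ℝ} (hφ : ∀ i, ExpGrowth (φ i)) :
    DiffMoments S (fun Θ => tiltLaw ν (μ Θ) (C Θ)) fun _ => φ := by
  have hint : ∀ f : (Fin n → ℝ) → ℝ, ExpGrowth f →
      DifferentiableOn ℝ (fun Θ => ∫ x, f x ∂(tiltLaw ν (μ Θ) (C Θ))) S := fun f hf => by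
    simp only [integral_tiltLaw]
    simp only [div_eq_mul_inv]
    refine (differentiableOn_integral_mul_gaussianPDF hν hf hμ hC hpos).mul
      (DifferentiableOn.inv ?_ fun Θ hΘ => (hν.integral_gaussianPDF_pos h0 _ (hpos Θ hΘ)).ne')
    simpa using differentiableOn_integral_mul_gaussianPDF hν (.const 1) hμ hC hpos
  refine ⟨fun Θ hΘ => isProbabilityMeasure_tiltLaw hν h0 (hpos Θ hΘ),
    fun Θ hΘ i => memLp_tiltLaw hν (hpos Θ hΘ) (hφ i), fun i => hint _ (hφ i), fun i j => ?_⟩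
  refine ((hint _ ((hφ i).mul (hφ j))).sub ((hint _ (hφ i)).mul (hint _ (hφ j)))).congr
    fun Θ hΘ => ?_
  have := isProbabilityMeasure_tiltLaw (μ := μ Θ) hν h0 (hpos Θ hΘ)
  rw [covariance_eq_sub (memLp_tiltLaw hν (hpos Θ hΘ) (hφ i))
    (memLp_tiltLaw hν (hpos Θ hΘ) (hφ j))]
  rfl

end DiffMoments

/-! ## Nondegenerate laws -/

/-- No nontrivial linear combination of the coordinates is almost surely constant. -/
def Nondeg {n : ℕ} (D : Measure (Fin n → ℝ)) : Prop :=
  ∀ (v : Fin n → ℝ) (c : ℝ), (∀ᵐ x ∂D, v ⬝ᵥ x = c) → v = 0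

/-- The quadratic form of the covariance matrix at v is the variance of v ⬝ x, which vanishes only
if v ⬝ x is almost surely constant. -/
theorem Nondeg.posDef {n : ℕ} {D : Measure (Fin n → ℝ)} [IsProbabilityMeasure D]
    (hD : Nondeg D) (hL : ∀ i, MemLp (fun x : Fin n → ℝ => x i) 2 D) :
    (Matrix.of fun i j => cov[fun x => x i, fun x => x j; D]).PosDef := by
  refine Matrix.PosDef.of_dotProduct_mulVec_pos ?_ fun v hv => ?_
  · ext i j
    simp [covariance_comm]
  · have hvL : MemLp (fun x : Fin n → ℝ => v ⬝ᵥ x) 2 D :=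
      memLp_finsetSum _ fun i _ => (hL i).const_mul _
    have h1 : star v ⬝ᵥ (Matrix.of fun i j => cov[fun x => x i, fun x => x j; D]).mulVec v =
        Var[fun x => v ⬝ᵥ x; D] := by
      rw [← covariance_self hvL.aestronglyMeasurable.aemeasurable]
      simp only [dotProduct]
      rw [covariance_fun_sum_fun_sum (fun k => (hL k).const_mul _) (fun k => (hL k).const_mul _)]
      simp only [covariance_const_mul_left, covariance_const_mul_right, Matrix.mulVec, dotProduct,
        Finset.mul_sum, Matrix.of_apply, Pi.star_apply, star_trivial]
      exact Finset.sum_congr rfl fun i _ => Finset.sum_congr rfl fun j _ => by ring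
    rw [h1]
    refine lt_of_le_of_ne (variance_nonneg _ _) fun h => hv (hD v (∫ x, v ⬝ᵥ x ∂D) ?_)
    exact ae_eq_integral_of_variance_eq_zero hvL h.symm

/-- For v ≠ 0 the equation v ⬝ x = c cuts out a proper affine subspace, which is a Lebesgue null
set. -/
theorem nondeg_of_absolutelyContinuous {n : ℕ} {D : Measure (Fin n → ℝ)} (h0 : D ≠ 0)
    (hD : D ≪ volume) : Nondeg D := by
  intro v c h
  by_contra hv
  let A : AffineSubspace ℝ (Fin n → ℝ) :=
    (AffineSubspace.mk' c ⊥).comap (dotProductBilin ℝ ℝ v).toAffineMap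
  have hA : ∀ x, x ∈ A ↔ v ⬝ᵥ x = c := fun x => by
    simp [A, AffineSubspace.mem_mk', sub_eq_zero]
  have hA' : A ≠ ⊤ := by
    intro hT
    have h1 : ∀ x, v ⬝ᵥ x = c := fun x => (hA x).1 (hT ▸ AffineSubspace.mem_top ℝ _ x)
    have h2 := h1 0
    have h3 := h1 v
    rw [dotProduct_zero] at h2
    rw [← h2] at h3
    exact hv (dotProduct_self_eq_zero.1 h3)
  have h1 := hD (Measure.addHaar_affineSubspace volume A hA')
  have h2 : D (A : Set (Fin n → ℝ))ᶜ = 0 := by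
    refine measure_mono_null (fun x hx hx' => hx ((hA x).2 hx')) (ae_iff.1 h)
  refine h0 (Measure.measure_univ_eq_zero.1 (measure_mono_null ?_ (measure_union_null h1 h2)))
  rw [Set.union_compl_self]

/-- Under a measure of full support, an almost sure equality of continuous functions holds
everywhere. Nondegeneracy can therefore be tested at chosen points. -/
theorem nondeg_map {n : ℕ} {Ω : Type*} [TopologicalSpace Ω] [MeasurableSpace Ω]
    [OpensMeasurableSpace Ω] {P : Measure Ω} [P.IsOpenPosMeasure] {φ : Ω → Fin n → ℝ}
    (hφ : Continuous φ) (h : ∀ (v : Fin n → ℝ) (c : ℝ), (∀ ω, v ⬝ᵥ φ ω = c) → v = 0) :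
    Nondeg (P.map φ) := by
  intro v c hv
  have hm : MeasurableSet {x : Fin n → ℝ | v ⬝ᵥ x = c} :=
    measurableSet_eq_fun (Continuous.measurable (by fun_prop)) measurable_const
  rw [ae_map_iff hφ.measurable.aemeasurable hm] at hv
  have hc : Continuous fun ω => v ⬝ᵥ φ ω := by simp only [dotProduct]; fun_prop
  exact h v c fun ω => congrFun ((hc.ae_eq_iff_eq P continuous_const).1 hv) ω

theorem isOpenPosMeasure_normal {m s : ℝ} (hs : s ≠ 0) : (normal m s).IsOpenPosMeasure :=
  normal_eq m s ▸ (gaussianReal_absolutelyContinuous' m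
    (Real.toNNReal_pos.2 (by positivity)).ne').isOpenPosMeasure

/-! ## Differentiable components -/

/-- A component of a Gaussian mixture whose weight is nonnegative, whose data are differentiable
in `Θ ∈ S` and whose covariance matrix is positive definite. -/
structure DiffComp {E : Type*} [NormedAddCommGroup E] [NormedSpace ℝ E] {n : ℕ} (S : Set E)
    (f : E → GComp n) : Prop where
  nonneg : ∀ Θ ∈ S, 0 ≤ (f Θ).weight
  weight : DifferentiableOn ℝ (fun Θ => (f Θ).weight) S
  mean : ∀ i, DifferentiableOn ℝ (fun Θ => (f Θ).mean i) S
  cov : ∀ i j, DifferentiableOn ℝ (fun Θ => (f Θ).cov i j) S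
  posDef : ∀ Θ ∈ S, (f Θ).cov.PosDef

instance {n : ℕ} (g : GComp n) : IsProbabilityMeasure g.law := by
  unfold GComp.law; infer_instance

section Generic

variable {E : Type*} [NormedAddCommGroup E] [NormedSpace ℝ E] {n : ℕ} {S : Set E}
  {f : E → GComp n} {w : E → ℝ}

theorem diffComp_momentMatch {D : E → Measure (Fin n → ℝ)}
    (hw0 : ∀ Θ ∈ S, 0 ≤ w Θ) (hw : DifferentiableOn ℝ w S)
    (hD : DiffMoments S D fun _ i x => x i) (hn : ∀ Θ ∈ S, Nondeg (D Θ)) :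
    DiffComp S fun Θ => momentMatch (w Θ) (D Θ) where
  nonneg := hw0
  weight := hw
  mean := hD.mean
  cov := hD.cov
  posDef Θ hΘ := by
    have := hD.prob Θ hΘ
    exact (hn Θ hΘ).posDef (hD.memLp Θ hΘ)

theorem DiffComp.diffMoments_comp (hf : DiffComp S f) {κ : Type*} {φ : κ → (Fin n → ℝ) → ℝ}
    (hφ : ∀ i, ExpGrowth (φ i)) : DiffMoments S (fun Θ => (f Θ).law) fun _ => φ :=
  (diffMoments_tiltLaw gaussTail_volume (NeZero.ne _) hf.mean hf.cov hf.posDef hφ).congr_measure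
    fun Θ hΘ => gaussian_eq_tiltLaw _ (hf.posDef Θ hΘ)

theorem DiffComp.diffMoments (hf : DiffComp S f) :
    DiffMoments S (fun Θ => (f Θ).law) fun _ i x => x i :=
  hf.diffMoments_comp fun i => .apply i

theorem DiffComp.isOpenPosMeasure (hf : DiffComp S f) {Θ : E} (hΘ : Θ ∈ S) :
    (f Θ).law.IsOpenPosMeasure :=
  isOpenPosMeasure_gaussian _ (hf.posDef Θ hΘ)

/-! ### Assignments -/

theorem DiffMoments.map_update {D : E → Measure (Fin n → ℝ)}
    (hD : DiffMoments S D fun _ i x => x i) (ξ : Fin n) {a : E → Fin n → ℝ} {a₀ : E → ℝ}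
    (ha : ∀ i, DifferentiableOn ℝ (fun Θ => a Θ i) S) (ha₀ : DifferentiableOn ℝ a₀ S) :
    DiffMoments S
      (fun Θ => (D Θ).map fun x => Function.update x ξ (∑ i, a Θ i * x i + a₀ Θ))
      fun _ i x => x i := by
  refine DiffMoments.map (fun Θ _ => Continuous.measurable (by fun_prop)) ?_
  refine (hD.affine (κ' := Fin n)
    (M := fun Θ i k => if i = ξ then a Θ k else if i = k then 1 else 0)
    (v := fun Θ i => if i = ξ then a₀ Θ else 0) (fun i k => ?_) fun i => ?_).congr
    fun Θ i x => ?_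
  · split_ifs
    exacts [ha k, differentiableOn_const _, differentiableOn_const _]
  · split_ifs
    exacts [ha₀, differentiableOn_const _]
  · by_cases h : i = ξ
    · subst h; simp
    · simp [h]

theorem DiffMoments.map_update_noise {D : E → Measure (Fin n → ℝ)}
    (hD : DiffMoments S D fun _ i x => x i) (ξ : Fin n) {a : E → Fin n → ℝ} {a₀ m s : E → ℝ}
    (ha : ∀ i, DifferentiableOn ℝ (fun Θ => a Θ i) S) (ha₀ : DifferentiableOn ℝ a₀ S)
    (hm : DifferentiableOn ℝ m S) (hs : DifferentiableOn ℝ s S) :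
    DiffMoments S (fun Θ => ((D Θ).prod (normal (m Θ) (s Θ))).map
      fun q => Function.update q.1 ξ (∑ i, a Θ i * q.1 i + a₀ Θ + q.2)) fun _ i x => x i := by
  refine DiffMoments.map (fun Θ _ => Continuous.measurable (by fun_prop)) ?_
  refine ((hD.prod_normal hm hs).affine (κ' := Fin n)
    (M := fun Θ i k => k.elim (if i = ξ then 1 else 0)
      fun k => if i = ξ then a Θ k else if i = k then 1 else 0)
    (v := fun Θ i => if i = ξ then a₀ Θ else 0) (fun i k => ?_) fun i => ?_).congr
    fun Θ i q => ?_
  · cases k with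
    | none => exact differentiableOn_const _
    | some k =>
      simp only [Option.elim]
      split_ifs
      exacts [ha k, differentiableOn_const _, differentiableOn_const _]
  · split_ifs
    exacts [ha₀, differentiableOn_const _]
  · rw [Fintype.sum_option]
    by_cases h : i = ξ
    · subst h; simp; ring
    · simp [h]

theorem dotProduct_update_zero {v : Fin n → ℝ} {ξ : Fin n} (t : ℝ) :
    v ⬝ᵥ Function.update 0 ξ t = v ξ * t := by
  change v ⬝ᵥ (Pi.single ξ t : Fin n → ℝ) = _
  rw [dotProduct_single]

theorem dotProduct_update_single {v : Fin n → ℝ} {ξ j : Fin n} (hj : j ≠ ξ) (r t : ℝ) :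
    v ⬝ᵥ Function.update (Pi.single j r) ξ t = v j * r + v ξ * t := by
  have : Function.update (Pi.single j r : Fin n → ℝ) ξ t = Pi.single j r + Pi.single ξ t := by
    ext i
    by_cases hi : i = ξ
    · subst hi; simp [hj.symm]
    · simp [hi]
  rw [this, dotProduct_add, dotProduct_single, dotProduct_single]

/-- The points 0 and e_ξ isolate v_ξ a_ξ, which forces v_ξ = 0; then e_j gives v_j = 0 for the other
j. -/
theorem nondeg_map_update {D : Measure (Fin n → ℝ)} [D.IsOpenPosMeasure] {ξ : Fin n}
    {a : Fin n → ℝ} (a₀ : ℝ) (ha : a ξ ≠ 0) :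
    Nondeg (D.map fun x => Function.update x ξ (∑ i, a i * x i + a₀)) := by
  refine nondeg_map (by fun_prop) fun v c h => ?_
  have h0 := h 0
  have h1 := h (Function.update 0 ξ 1)
  rw [dotProduct_update_zero] at h0
  rw [Function.update_idem, dotProduct_update_zero] at h1
  simp [Function.update_apply] at h0 h1
  have hξ : v ξ = 0 := by
    have : v ξ * a ξ = 0 := by linarith
    exact (mul_eq_zero.1 this).resolve_right ha
  ext j
  by_cases hj : j = ξ
  · rw [hj]; exact hξ
  · have h2 := h (Pi.single j 1)
    rw [dotProduct_update_single hj, hξ] at h2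
    rw [hξ] at h0
    simpa [← h0] using h2

/-- The noise direction now plays the role of e_ξ, so no condition on the coefficients is needed. -/
theorem nondeg_map_update_noise {D : Measure (Fin n → ℝ)} [SFinite D] [D.IsOpenPosMeasure]
    {N : Measure ℝ} [SFinite N] [N.IsOpenPosMeasure] (ξ : Fin n) (a : Fin n → ℝ) (a₀ : ℝ) :
    Nondeg ((D.prod N).map fun q => Function.update q.1 ξ (∑ i, a i * q.1 i + a₀ + q.2)) := by
  refine nondeg_map (by fun_prop) fun v c h => ?_
  have h0 := h (0, 0)
  have h1 := h (0, 1)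
  rw [dotProduct_update_zero] at h0 h1
  simp at h0 h1
  have hξ : v ξ = 0 := by linarith
  ext j
  by_cases hj : j = ξ
  · rw [hj]; exact hξ
  · have h2 := h (Pi.single j 1, 0)
    rw [dotProduct_update_single hj, hξ] at h2
    rw [hξ] at h0
    simpa [← h0] using h2

/-- The product x_j x_k takes the same value at e_i and -e_i, so comparing these two points gives
v_i = 0 for i ≠ ξ. The all-ones vector then gives v_ξ = 0, whether or not ξ is one of the factors.
-/
theorem nondeg_map_update_prod {D : Measure (Fin n → ℝ)} [D.IsOpenPosMeasure] (ξ j k : Fin n) :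
    Nondeg (D.map fun x => Function.update x ξ (x j * x k)) := by
  refine nondeg_map (by fun_prop) fun v c h => ?_
  have h0 := h 0
  rw [dotProduct_update_zero] at h0
  simp only [Pi.zero_apply, mul_zero] at h0
  have hne : ∀ i, i ≠ ξ → v i = 0 := fun i hi => by
    have h1 := h (Pi.single i 1)
    have h2 := h (Pi.single i (-1))
    rw [dotProduct_update_single hi, ← h0] at h1 h2
    have h3 : (Pi.single i (-1) : Fin n → ℝ) = -Pi.single i 1 := Pi.single_neg i 1
    rw [h3] at h2
    simp only [Pi.neg_apply, neg_mul_neg] at h2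
    linarith
  have hξ : v ξ = 0 := by
    have h1 := h 1
    have h2 : v = Pi.single ξ (v ξ) := by
      ext i
      by_cases hi : i = ξ
      · subst hi; simp
      · simp [hi, hne i hi]
    rw [h2, single_dotProduct] at h1
    simpa [← h0] using h1
  ext i
  by_cases hi : i = ξ
  · rw [hi]; exact hξ
  · exact hne i hi

theorem DiffComp.assign_lin (hf : DiffComp S f) {ξ : Fin n} {a : E → Fin n → ℝ} {a₀ : E → ℝ}
    (ha : ∀ i, DifferentiableOn ℝ (fun Θ => a Θ i) S) (ha₀ : DifferentiableOn ℝ a₀ S)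
    (haξ : ∀ Θ ∈ S, a Θ ξ ≠ 0) :
    DiffComp S fun Θ => momentMatch (f Θ).weight
      ((f Θ).law.map fun x => Function.update x ξ (∑ i, a Θ i * x i + a₀ Θ)) :=
  diffComp_momentMatch hf.nonneg hf.weight (hf.diffMoments.map_update ξ ha ha₀) fun Θ hΘ => by
    have := hf.isOpenPosMeasure hΘ
    exact nondeg_map_update _ (haξ Θ hΘ)

theorem DiffComp.assign_noise (hf : DiffComp S f) (hw0 : ∀ Θ ∈ S, 0 ≤ w Θ)
    (hw : DifferentiableOn ℝ w S) (ξ : Fin n) {a : E → Fin n → ℝ} {a₀ m s : E → ℝ}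
    (ha : ∀ i, DifferentiableOn ℝ (fun Θ => a Θ i) S) (ha₀ : DifferentiableOn ℝ a₀ S)
    (hm : DifferentiableOn ℝ m S) (hs : DifferentiableOn ℝ s S) (hs0 : ∀ Θ ∈ S, s Θ ≠ 0) :
    DiffComp S fun Θ => momentMatch (w Θ) (((f Θ).law.prod (normal (m Θ) (s Θ))).map
      fun q => Function.update q.1 ξ (∑ i, a Θ i * q.1 i + a₀ Θ + q.2)) :=
  diffComp_momentMatch hw0 hw (hf.diffMoments.map_update_noise ξ ha ha₀ hm hs) fun Θ hΘ => by
    have := hf.isOpenPosMeasure hΘ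
    have := isOpenPosMeasure_normal (m := m Θ) (hs0 Θ hΘ)
    exact nondeg_map_update_noise ξ _ _

theorem DiffComp.assign_prod (hf : DiffComp S f) (ξ j k : Fin n) :
    DiffComp S fun Θ => momentMatch (f Θ).weight
      ((f Θ).law.map fun x => Function.update x ξ (x j * x k)) := by
  refine diffComp_momentMatch hf.nonneg hf.weight (DiffMoments.map
    (fun Θ _ => Continuous.measurable (by fun_prop)) (hf.diffMoments_comp fun i => ?_))
    fun Θ hΘ => ?_
  · by_cases hi : i = ξ
    · subst hi
      simpa using (ExpGrowth.apply j).mul (ExpGrowth.apply k)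
    · simpa [hi] using ExpGrowth.apply i
  · have := hf.isOpenPosMeasure hΘ
    exact nondeg_map_update_prod ξ j k

/-! ### Random assignments -/

theorem tensor_dropVar (ξ : Fin n) (D : Measure (Fin n → ℝ)) [SFinite D] (N : Measure ℝ)
    [SFinite N] :
    tensor ξ (dropVar ξ D) N = (D.prod N).map fun q => Function.update q.1 ξ q.2 := by
  have hm : Measurable fun (x : Fin n → ℝ) (j : {j : Fin n // j ≠ ξ}) => x j := by fun_prop
  have h1 := Measure.map_prod_map D N hm measurable_id
  rw [Measure.map_id] at h1
  rw [tensor, dropVar, h1, Measure.map_map (continuous_glue ξ).measurable (by fun_prop)]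
  congr 1
  ext q j
  by_cases h : j = ξ
  · subst h; simp [glue]
  · simp [glue, h]

/-- A random assignment is a noisy assignment of the zero expression, with the sampled normal
variable as the noise. -/
theorem DiffComp.rnd (hf : DiffComp S f) (hw0 : ∀ Θ ∈ S, 0 ≤ w Θ)
    (hw : DifferentiableOn ℝ w S) (ξ : Fin n) {m s : E → ℝ}
    (hm : DifferentiableOn ℝ m S) (hs : DifferentiableOn ℝ s S) (hs0 : ∀ Θ ∈ S, s Θ ≠ 0) :
    DiffComp S fun Θ => momentMatch (w Θ)
      (tensor ξ (dropVar ξ (f Θ).law) (normal (m Θ) (s Θ))) := by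
  have h := hf.assign_noise hw0 hw ξ (a := fun _ _ => 0) (a₀ := fun _ => 0)
    (fun _ => differentiableOn_const _) (differentiableOn_const _) hm hs hs0
  simpa [tensor_dropVar] using h

/-! ### Conditioning to sets -/

/-- A family of sets which are translates, by vectors differentiable in `Θ ∈ S`, of a fixed
measurable set of positive measure. -/
def ShiftFamily (S : Set E) (A : E → Set (Fin n → ℝ)) : Prop :=
  ∃ (A₀ : Set (Fin n → ℝ)) (u : E → Fin n → ℝ), MeasurableSet A₀ ∧ volume A₀ ≠ 0 ∧
    (∀ i, DifferentiableOn ℝ (fun Θ => u Θ i) S) ∧ ∀ Θ ∈ S, A Θ = {x | x - u Θ ∈ A₀}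

/-- Moves the parameter from the set into the mean, so that the domain of integration is fixed and
no boundary terms have to be differentiated. -/
theorem gaussian_real_shift (μ u : Fin n → ℝ) (C : Matrix (Fin n) (Fin n) ℝ)
    {A₀ : Set (Fin n → ℝ)} (hA₀ : MeasurableSet A₀) :
    (gaussian μ C).real {x | x - u ∈ A₀} = (gaussian (μ - u) C).real A₀ := by
  have hA : MeasurableSet {x : Fin n → ℝ | x - u ∈ A₀} := (measurable_id.sub_const u) hA₀
  rw [← gaussian_map_add μ u, map_measureReal_apply (by fun_prop) hA]
  congr 1
  ext x; simp

theorem cond_gaussian_shift (μ u : Fin n → ℝ) (C : Matrix (Fin n) (Fin n) ℝ)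
    {A₀ : Set (Fin n → ℝ)} (hA₀ : MeasurableSet A₀) :
    ProbabilityTheory.cond (gaussian μ C) {x | x - u ∈ A₀} =
      (ProbabilityTheory.cond (gaussian (μ - u) C) A₀).map fun x => x + u := by
  have hm : Measurable fun x : Fin n → ℝ => x + u := by fun_prop
  have hA : MeasurableSet {x : Fin n → ℝ | x - u ∈ A₀} := (measurable_id.sub_const u) hA₀
  have hp : (fun x : Fin n → ℝ => x + u) ⁻¹' {x | x - u ∈ A₀} = A₀ := by ext x; simp
  rw [ProbabilityTheory.cond, ProbabilityTheory.cond, Measure.map_smul, ← gaussian_map_add μ u,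
    Measure.map_apply hm hA, Measure.restrict_map hm hA, hp]

theorem DiffComp.differentiableOn_real (hf : DiffComp S f) {A : E → Set (Fin n → ℝ)}
    (hA : ShiftFamily S A) : DifferentiableOn ℝ (fun Θ => (f Θ).law.real (A Θ)) S := by
  obtain ⟨A₀, u, hm, h0, hu, hA⟩ := hA
  have h := differentiableOn_integral_mul_gaussianPDF (gaussTail_volume.restrict A₀) (.const 1)
    (μ := fun Θ => (f Θ).mean - u Θ) (fun i => (hf.mean i).sub (hu i)) hf.cov hf.posDef
  refine h.congr fun Θ hΘ => ?_
  rw [hA Θ hΘ, GComp.law, gaussian_real_shift _ _ _ hm,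
    gaussian_real_eq_integral _ (hf.posDef Θ hΘ) hm]
  simp

theorem DiffComp.real_pos (hf : DiffComp S f) {A : E → Set (Fin n → ℝ)}
    (hA : ShiftFamily S A) {Θ : E} (hΘ : Θ ∈ S) : 0 < (f Θ).law.real (A Θ) := by
  obtain ⟨A₀, u, hm, h0, hu, hA⟩ := hA
  rw [hA Θ hΘ, GComp.law, gaussian_real_shift _ _ _ hm,
    gaussian_real_eq_integral _ (hf.posDef Θ hΘ) hm]
  exact (gaussTail_volume.restrict A₀).integral_gaussianPDF_pos
    (by rwa [Ne, Measure.restrict_eq_zero]) _ (hf.posDef Θ hΘ)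

/-- The translated conditional law has a fixed base measure, Lebesgue measure on A₀; translating
back only adds u to the mean. It is nondegenerate because conditioning preserves absolute
continuity. -/
theorem DiffComp.cond (hf : DiffComp S f) (hw0 : ∀ Θ ∈ S, 0 ≤ w Θ)
    (hw : DifferentiableOn ℝ w S) {A : E → Set (Fin n → ℝ)} (hA : ShiftFamily S A) :
    DiffComp S fun Θ => momentMatch (w Θ) (ProbabilityTheory.cond (f Θ).law (A Θ)) := by
  have hpos := fun Θ hΘ => hf.real_pos hA (Θ := Θ) hΘ
  obtain ⟨A₀, u, hm, h0, hu, hA⟩ := hA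
  refine diffComp_momentMatch hw0 hw ?_ fun Θ hΘ => ?_
  · have h := diffMoments_tiltLaw (gaussTail_volume.restrict A₀)
      (by rwa [Ne, Measure.restrict_eq_zero]) (μ := fun Θ => (f Θ).mean - u Θ)
      (fun i => (hf.mean i).sub (hu i)) hf.cov hf.posDef (φ := fun (i : Fin n) x => x i)
      fun i => .apply i
    have h2 := h.affine (M := fun _ (i k : Fin n) => if i = k then 1 else 0) (v := u)
      (fun i k => differentiableOn_const _) hu
    refine (DiffMoments.map (φ := fun Θ x => x + u Θ) (fun Θ _ => by fun_prop)
      (h2.congr fun Θ i x => by simp)).congr_measure fun Θ hΘ => ?_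
    rw [hA Θ hΘ, GComp.law, cond_gaussian_shift _ _ _ hm,
      cond_gaussian_eq_tiltLaw _ (hf.posDef Θ hΘ) hm h0]
  · have h1 : (f Θ).law (A Θ) ≠ 0 := fun h => by
      have := hpos Θ hΘ
      rw [measureReal_def, h] at this
      simp at this
    have := cond_isProbabilityMeasure h1
    exact nondeg_of_absolutelyContinuous (IsProbabilityMeasure.ne_zero _)
      (cond_absolutelyContinuous.trans
        (gaussian_absolutelyContinuous_volume _ (hf.posDef Θ hΘ)))

/-! ### Conditioning to hyperplanes -/

/-- Lebesgue measure on the hyperplane `x_ξ = 0`. -/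
def hyperplaneVolume (ξ : Fin n) : Measure (Fin n → ℝ) :=
  (volume : Measure ({j : Fin n // j ≠ ξ} → ℝ)).map fun y => glue ξ y 0

theorem gaussTail_hyperplaneVolume (ξ : Fin n) : GaussTail (hyperplaneVolume ξ) :=
  gaussTail_map_glue ξ

theorem hyperplaneVolume_ne_zero (ξ : Fin n) : hyperplaneVolume ξ ≠ 0 := by
  rw [hyperplaneVolume, Ne, Measure.map_eq_zero_iff (continuous_glue_left ξ 0).measurable.aemeasurable]
  exact NeZero.ne _

/-- The analogue of the translation argument for hyperplanes: the value c moves into the mean and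
the hyperplane becomes x_ξ = 0. -/
theorem gaussianPDF_glue (μ : Fin n → ℝ) (C : Matrix (Fin n) (Fin n) ℝ) (ξ : Fin n)
    (y : {j : Fin n // j ≠ ξ} → ℝ) (c : ℝ) :
    gaussianPDF μ C (glue ξ y c) = gaussianPDF (μ - Pi.single ξ c) C (glue ξ y 0) := by
  have : glue ξ y c - μ = glue ξ y 0 - (μ - Pi.single ξ c) := by
    ext j
    by_cases h : j = ξ
    · subst h; simp [glue]
    · simp [glue, h]
  rw [gaussianPDF, gaussianPDF, this]

theorem GComp.slice_eq (g : GComp n) (ξ : Fin n) (c : ℝ) :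
    g.slice ξ c = ∫ x, gaussianPDF (g.mean - Pi.single ξ c) g.cov x ∂(hyperplaneVolume ξ) := by
  rw [hyperplaneVolume, integral_map (continuous_glue_left ξ 0).measurable.aemeasurable
    (continuous_gaussianPDF _ _).aestronglyMeasurable]
  simp only [GComp.slice, gaussianPDF_glue g.mean g.cov ξ _ c]

theorem GComp.map_condSlice (g : GComp n) (ξ : Fin n) (c : ℝ) :
    (g.condSlice ξ c).map (fun y => glue ξ y 0) =
      tiltLaw (hyperplaneVolume ξ) (g.mean - Pi.single ξ c) g.cov := by
  rw [tiltLaw, hyperplaneVolume, ← map_withDensity_comp (continuous_glue_left ξ 0).measurable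
    (by fun_prop), ← hyperplaneVolume, ← GComp.slice_eq]
  simp only [GComp.condSlice, gaussianPDF_glue g.mean g.cov ξ _ c]
  rfl

theorem dropVar_map_glue (ξ : Fin n) (c : ℝ) (D : Measure ({j : Fin n // j ≠ ξ} → ℝ)) :
    dropVar ξ (D.map fun y => glue ξ y c) = D := by
  rw [dropVar, Measure.map_map (by fun_prop) (continuous_glue_left ξ c).measurable]
  convert Measure.map_id
  ext y j
  simp [glue, j.2]

/-- Every state is the glueing of its own coordinates, so v ⬝ x would be constant on the whole
space. -/
theorem nondeg_tensor {ξ : Fin n} {D : Measure ({j : Fin n // j ≠ ξ} → ℝ)} [SFinite D]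
    [D.IsOpenPosMeasure] {N : Measure ℝ} [SFinite N] [N.IsOpenPosMeasure] :
    Nondeg (tensor ξ D N) := by
  refine nondeg_map (continuous_glue ξ) fun v c h => ?_
  have hg : ∀ x : Fin n → ℝ, glue ξ (fun j => x j) (x ξ) = x := fun x => by
    ext j
    by_cases hj : j = ξ
    · subst hj; simp [glue]
    · simp [glue, hj]
  have h' : ∀ x : Fin n → ℝ, v ⬝ᵥ x = c := fun x => by
    simpa [hg] using h (fun j => x j, x ξ)
  have h0 := h' 0
  have h1 := h' v
  rw [dotProduct_zero] at h0
  rw [← h0] at h1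
  exact dotProduct_self_eq_zero.1 h1

theorem DiffComp.diffMean_sub_single (hf : DiffComp S f) (ξ : Fin n) {c : E → ℝ}
    (hc : DifferentiableOn ℝ c S) (i : Fin n) :
    DifferentiableOn ℝ (fun Θ => ((f Θ).mean - Pi.single ξ (c Θ) : Fin n → ℝ) i) S := by
  refine (hf.mean i).sub ?_
  by_cases hi : i = ξ
  · subst hi; simpa using hc
  · simp [hi]

theorem DiffComp.differentiableOn_slice (hf : DiffComp S f) (ξ : Fin n) {c : E → ℝ}
    (hc : DifferentiableOn ℝ c S) : DifferentiableOn ℝ (fun Θ => (f Θ).slice ξ (c Θ)) S := by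
  simp only [GComp.slice_eq]
  simpa using differentiableOn_integral_mul_gaussianPDF (gaussTail_hyperplaneVolume ξ) (.const 1)
    (hf.diffMean_sub_single ξ hc) hf.cov hf.posDef

theorem DiffComp.slice_pos (hf : DiffComp S f) (ξ : Fin n) (c : ℝ) {Θ : E} (hΘ : Θ ∈ S) :
    0 < (f Θ).slice ξ c := by
  rw [GComp.slice_eq]
  exact (gaussTail_hyperplaneVolume ξ).integral_gaussianPDF_pos (hyperplaneVolume_ne_zero ξ) _
    (hf.posDef Θ hΘ)

theorem DiffComp.condSlice (hf : DiffComp S f) (hw0 : ∀ Θ ∈ S, 0 ≤ w Θ)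
    (hw : DifferentiableOn ℝ w S) (ξ : Fin n) {c s : E → ℝ} (hc : DifferentiableOn ℝ c S)
    (hs : DifferentiableOn ℝ s S) (hs0 : ∀ Θ ∈ S, s Θ ≠ 0) :
    DiffComp S fun Θ => momentMatch (w Θ)
      (tensor ξ ((f Θ).condSlice ξ (c Θ)) (normal (c Θ) (s Θ))) := by
  have hsf : ∀ Θ, SFinite ((f Θ).condSlice ξ (c Θ)) := fun Θ => by
    unfold GComp.condSlice; infer_instance
  refine diffComp_momentMatch hw0 hw ?_ fun Θ hΘ => ?_
  · have h := (diffMoments_tiltLaw (gaussTail_hyperplaneVolume ξ) (hyperplaneVolume_ne_zero ξ)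
      (hf.diffMean_sub_single ξ hc) hf.cov hf.posDef (φ := fun (i : Fin n) x => x i)
      fun i => .apply i).map_update_noise ξ (a := fun _ _ => 0) (a₀ := fun _ => 0)
      (fun _ => differentiableOn_const _) (differentiableOn_const _) hc hs
    refine h.congr_measure fun Θ hΘ => ?_
    have := hsf Θ
    -- The slice law is the marginal of its own image in the hyperplane x_ξ = 0. The tensor product
    -- thus becomes an update of coordinate ξ under a `tiltLaw` on that hyperplane.
    rw [← dropVar_map_glue ξ 0 ((f Θ).condSlice ξ (c Θ)), tensor_dropVar,
      GComp.map_condSlice]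
    simp [hyperplaneVolume]
  · have := isOpenPosMeasure_normal (m := c Θ) (hs0 Θ hΘ)
    have := hsf Θ
    have hac : volume ≪ (f Θ).condSlice ξ (c Θ) := by
      refine withDensity_absolutelyContinuous' ?_ (Filter.Eventually.of_forall fun y => ?_)
      · exact (Continuous.measurable (((continuous_gaussianPDF _ _).comp
          (continuous_glue_left ξ (c Θ))).div_const _)).ennreal_ofReal.aemeasurable
      · have := div_pos (gaussianPDF_pos (f Θ).mean (hf.posDef Θ hΘ) (glue ξ y (c Θ)))
          (hf.slice_pos ξ (c Θ) hΘ)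
        simpa using this
    have := hac.isOpenPosMeasure
    exact nondeg_tensor

end Generic

/-! ## Lists -/

/-- Components of weight zero are allowed, so positivity has to come from some component of positive
weight; nonnegativity is carried along for the induction. -/
theorem list_sum_nonneg_and_pos {α : Type*} {L : List α} {w r : α → ℝ}
    (hw : ∀ a ∈ L, 0 ≤ w a) (hr : ∀ a ∈ L, 0 < r a) :
    0 ≤ (L.map fun a => w a * r a).sum ∧
      (0 < (L.map w).sum → 0 < (L.map fun a => w a * r a).sum) := by
  induction L with
  | nil => simp
  | cons a L ih =>
    obtain ⟨h1, h2⟩ := ih (fun b hb => hw b (List.mem_cons_of_mem _ hb))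
      fun b hb => hr b (List.mem_cons_of_mem _ hb)
    have ha := hw a List.mem_cons_self
    have hra := hr a List.mem_cons_self
    simp only [List.map_cons, List.sum_cons]
    refine ⟨add_nonneg (mul_nonneg ha hra.le) h1, fun h => ?_⟩
    obtain ha0 | ha0 := ha.eq_or_lt
    · rw [← ha0, zero_add] at h
      rw [← ha0, zero_mul, zero_add]
      exact h2 h
    · exact add_pos_of_pos_of_nonneg (mul_pos ha0 hra) h1

theorem list_sum_map_mul_right {α : Type*} (L : List α) (w : α → ℝ) (c : ℝ) :
    (L.map fun a => w a * c).sum = (L.map w).sum * c := by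
  induction L with
  | nil => simp
  | cons a L ih => simp [ih, add_mul]

theorem list_sum_map_mul_left {α : Type*} (L : List α) (w : α → ℝ) (c : ℝ) :
    (L.map fun a => c * w a).sum = c * (L.map w).sum := by
  induction L with
  | nil => simp
  | cons a L ih => simp [ih, mul_add]

section Mixture

variable {E : Type*} [NormedAddCommGroup E] [NormedSpace ℝ E] {n : ℕ} {S : Set E}

theorem differentiableOn_list_sum {α : Type*} {L : List α} {h : α → E → ℝ}
    (hL : ∀ a ∈ L, DifferentiableOn ℝ (h a) S) :
    DifferentiableOn ℝ (fun Θ => (L.map fun a => h a Θ).sum) S := by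
  induction L with
  | nil => simp
  | cons a L ih =>
    simp only [List.map_cons, List.sum_cons]
    exact (hL a List.mem_cons_self).add (ih fun b hb => hL b (List.mem_cons_of_mem _ hb))

/-! ## Differentiable mixtures -/

/-- The mixtures `D Θ`, `Θ ∈ S`, consist of a fixed list of differentiable components, with
total weight `W Θ`. -/
def MixOn (S : Set E) (D : E → GM n) (W : E → ℝ) : Prop :=
  ∃ L : List (E → GComp n), (∀ Θ ∈ S, D Θ = L.map fun f => f Θ) ∧ (∀ f ∈ L, DiffComp S f) ∧
    ∀ Θ ∈ S, (L.map fun f => (f Θ).weight).sum = W Θ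

variable {D D' : E → GM n} {W W' : E → ℝ}

theorem MixOn.congr (h : MixOn S D W) (hD : ∀ Θ ∈ S, D' Θ = D Θ) : MixOn S D' W := by
  obtain ⟨L, h1, h2, h3⟩ := h
  exact ⟨L, fun Θ hΘ => (hD Θ hΘ).trans (h1 Θ hΘ), h2, h3⟩

theorem MixOn.append (h : MixOn S D W) (h' : MixOn S D' W') :
    MixOn S (fun Θ => D Θ ++ D' Θ) fun Θ => W Θ + W' Θ := by
  obtain ⟨L, h1, h2, h3⟩ := h
  obtain ⟨L', h1', h2', h3'⟩ := h'
  refine ⟨L ++ L', fun Θ hΘ => ?_, fun f hf => ?_, fun Θ hΘ => ?_⟩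
  · simp only [h1 Θ hΘ, h1' Θ hΘ, List.map_append]
  · exact (List.mem_append.1 hf).elim (h2 f) (h2' f)
  · rw [List.map_append, List.sum_append, h3 Θ hΘ, h3' Θ hΘ]

theorem MixOn.map (h : MixOn S D W) {G : E → GComp n → GComp n}
    (hG : ∀ f, DiffComp S f → DiffComp S fun Θ => G Θ (f Θ))
    (hW : ∀ Θ ∈ S, ((D Θ).map fun g => (G Θ g).weight).sum = W' Θ) :
    MixOn S (fun Θ => (D Θ).map (G Θ)) W' := by
  obtain ⟨L, h1, h2, h3⟩ := h
  refine ⟨L.map fun f Θ => G Θ (f Θ), fun Θ hΘ => ?_, fun f hf => ?_, fun Θ hΘ => ?_⟩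
  · simp [h1 Θ hΘ]
  · obtain ⟨f', hf', rfl⟩ := List.mem_map.1 hf
    exact hG f' (h2 f' hf')
  · rw [← hW Θ hΘ, h1 Θ hΘ]
    simp [Function.comp_def]

theorem MixOn.sum_weight (h : MixOn S D W) {Θ : E} (hΘ : Θ ∈ S) :
    ((D Θ).map fun g => g.weight).sum = W Θ := by
  obtain ⟨L, h1, h2, h3⟩ := h
  rw [← h3 Θ hΘ, h1 Θ hΘ]
  simp [Function.comp_def]

theorem MixOn.differentiableOn_sum (h : MixOn S D W) {k : E → GComp n → ℝ}
    (hk : ∀ f, DiffComp S f → DifferentiableOn ℝ (fun Θ => k Θ (f Θ)) S) :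
    DifferentiableOn ℝ (fun Θ => ((D Θ).map (k Θ)).sum) S := by
  obtain ⟨L, h1, h2, h3⟩ := h
  refine (differentiableOn_list_sum (h := fun f Θ => k Θ (f Θ)) fun f hf => hk f (h2 f hf)).congr
    fun Θ hΘ => ?_
  rw [h1 Θ hΘ]
  simp [Function.comp_def]

theorem MixOn.sum_pos (h : MixOn S D fun _ => 1) {Θ : E} (hΘ : Θ ∈ S) {r : GComp n → ℝ}
    (hr : ∀ f, DiffComp S f → 0 < r (f Θ)) :
    0 < ((D Θ).map fun g => g.weight * r g).sum := by
  obtain ⟨L, h1, h2, h3⟩ := h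
  have := (list_sum_nonneg_and_pos (L := L) (w := fun f => (f Θ).weight) (r := fun f => r (f Θ))
    (fun f hf => (h2 f hf).nonneg Θ hΘ) fun f hf => hr f (h2 f hf)).2 (by
      rw [h3 Θ hΘ]; exact one_pos)
  rw [h1 Θ hΘ]
  simpa [Function.comp_def] using this

theorem MixOn.differentiableOn_pdf (h : MixOn S D W) (x : Fin n → ℝ) :
    DifferentiableOn ℝ (fun Θ => GM.pdf (D Θ) x) S :=
  h.differentiableOn_sum (k := fun _ g => g.weight * gaussianPDF g.mean g.cov x) fun _ hf =>
    hf.weight.mul (differentiableOn_gaussianPDF hf.mean hf.cov hf.posDef x)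

theorem DiffComp.scale {f : E → GComp n} (hf : DiffComp S f) {q : E → ℝ}
    (hq0 : ∀ Θ ∈ S, 0 ≤ q Θ) (hq : DifferentiableOn ℝ q S) :
    DiffComp S fun Θ => { f Θ with weight := q Θ * (f Θ).weight } where
  nonneg Θ hΘ := mul_nonneg (hq0 Θ hΘ) (hf.nonneg Θ hΘ)
  weight := hq.mul hf.weight
  mean := hf.mean
  cov := hf.cov
  posDef := hf.posDef

/-- Induction on the list of paths, during which the total weight accumulates; this is why `MixOn`
records a weight function instead of fixing it to be 1. -/
theorem MixOn.flatMap {α : Type*} {L : List α} {D : α → E → GM n} {q : α → E → ℝ}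
    (hD : ∀ a ∈ L, MixOn S (D a) fun _ => 1) (hq0 : ∀ a ∈ L, ∀ Θ ∈ S, 0 ≤ q a Θ)
    (hq : ∀ a ∈ L, DifferentiableOn ℝ (q a) S) :
    MixOn S (fun Θ => L.flatMap fun a => (D a Θ).map fun g => { g with weight := q a Θ * g.weight })
      fun Θ => (L.map fun a => q a Θ).sum := by
  induction L with
  | nil => exact ⟨[], by simp, by simp, by simp⟩
  | cons a L ih =>
    have h1 := ih (fun b hb => hD b (List.mem_cons_of_mem _ hb))
      (fun b hb => hq0 b (List.mem_cons_of_mem _ hb)) fun b hb => hq b (List.mem_cons_of_mem _ hb)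
    have h2 : MixOn S (fun Θ => (D a Θ).map fun g => { g with weight := q a Θ * g.weight })
        (q a) := by
      refine (hD a List.mem_cons_self).map (fun f hf => hf.scale (hq0 a List.mem_cons_self)
        (hq a List.mem_cons_self)) fun Θ hΘ => ?_
      simp only [list_sum_map_mul_left]
      rw [(hD a List.mem_cons_self).sum_weight hΘ, mul_one]
    simpa using h2.append h1

end Mixture

theorem MixOn.differentiableGM {n m : ℕ} {S : Set (Fin m → ℝ)} {D : (Fin m → ℝ) → GM n}
    (h : MixOn S D fun _ => 1) : DifferentiableGM D S := by
  obtain ⟨L, h1, h2, h3⟩ := h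
  refine ⟨L.length, fun i Θ => (L.get i Θ).weight, fun i Θ => (L.get i Θ).mean,
    fun i Θ => (L.get i Θ).cov, fun Θ hΘ => ?_, fun Θ hΘ => ⟨fun i => ?_, ?_⟩,
    fun i => (h2 _ (L.get_mem i)).weight, fun i => (h2 _ (L.get_mem i)).mean,
    fun i => (h2 _ (L.get_mem i)).cov, fun i => (h2 _ (L.get_mem i)).posDef⟩
  · rw [h1 Θ hΘ]
    conv_lhs => rw [← List.ofFn_get L, List.map_ofFn]
    rfl
  · exact (h2 _ (L.get_mem i)).nonneg Θ hΘ
  · refine Eq.trans ?_ (h3 Θ hΘ)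
    rw [← List.sum_ofFn]
    conv_rhs => rw [← List.ofFn_get L, List.map_ofFn]
    rfl

/-! ## Smoothed predicates -/

theorem Coef.differentiableOn_eval {m : ℕ} (c : Coef m) (S : Set (Fin m → ℝ)) :
    DifferentiableOn ℝ (fun Θ => c.eval Θ) S := by
  cases c with
  | const c => exact differentiableOn_const c
  | param i => exact (differentiable_apply i).differentiableOn

section Predicates

variable {n m : ℕ} {S : Set (Fin m → ℝ)}

theorem shiftFamily_univ : ShiftFamily S fun _ => (Set.univ : Set (Fin n → ℝ)) :=
  ⟨Set.univ, 0, MeasurableSet.univ, by simpa using NeZero.ne (volume : Measure (Fin n → ℝ)),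
    fun i => differentiableOn_const _, fun Θ _ => by simp⟩

/-- The set constrains only coordinate ξ, so translating all coordinates by the value of c serves as
well. The interval inside B is what gives positive volume. -/
theorem shiftFamily_coord (ξ : Fin n) (c : Coef m) {B : Set ℝ} (hB : MeasurableSet B) {a b : ℝ}
    (hab : a < b) (hsub : Set.Ioo a b ⊆ B) {A : (Fin m → ℝ) → Set (Fin n → ℝ)}
    (hA : ∀ Θ, A Θ = {x | x ξ - c.eval Θ ∈ B}) : ShiftFamily S A := by
  refine ⟨{x | x ξ ∈ B}, fun Θ _ => c.eval Θ, measurable_pi_apply ξ hB, ?_,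
    fun i => c.differentiableOn_eval S, fun Θ _ => hA Θ⟩
  have ho : IsOpen {x : Fin n → ℝ | x ξ ∈ Set.Ioo a b} :=
    isOpen_Ioo.preimage (continuous_apply ξ)
  have hne : {x : Fin n → ℝ | x ξ ∈ Set.Ioo a b}.Nonempty :=
    ⟨fun _ => (a + b) / 2, by constructor <;> linarith⟩
  exact fun h => (ho.measure_pos volume hne).ne'
    (measure_mono_null (fun x hx => hsub hx) h)

theorem shiftFamily_lt (ξ : Fin n) (c : Coef m) (t : ℝ) :
    ShiftFamily S fun Θ => {x : Fin n → ℝ | x ξ < c.eval Θ + t} :=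
  shiftFamily_coord ξ c (measurableSet_Iio (a := t)) (sub_one_lt t) (fun _ h => h.2) fun Θ => by
    ext x; simp [sub_lt_iff_lt_add']

theorem shiftFamily_le (ξ : Fin n) (c : Coef m) (t : ℝ) :
    ShiftFamily S fun Θ => {x : Fin n → ℝ | x ξ ≤ c.eval Θ + t} :=
  shiftFamily_coord ξ c (measurableSet_Iic (a := t)) (sub_one_lt t) (fun _ h => h.2.le)
    fun Θ => by ext x; simp [add_comm]

theorem shiftFamily_gt (ξ : Fin n) (c : Coef m) (t : ℝ) :
    ShiftFamily S fun Θ => {x : Fin n → ℝ | c.eval Θ + t < x ξ} :=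
  shiftFamily_coord ξ c (measurableSet_Ioi (a := t)) (lt_add_one t) (fun _ h => h.1) fun Θ => by
    ext x; simp [lt_sub_iff_add_lt']

theorem shiftFamily_ge (ξ : Fin n) (c : Coef m) (t : ℝ) :
    ShiftFamily S fun Θ => {x : Fin n → ℝ | c.eval Θ + t ≤ x ξ} :=
  shiftFamily_coord ξ c (measurableSet_Ici (a := t)) (lt_add_one t) (fun _ h => h.1.le)
    fun Θ => by ext x; simp [le_sub_iff_add_le']

theorem shiftFamily_strip (ξ : Fin n) (c : Coef m) {t : ℝ} (ht : 0 < t) :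
    ShiftFamily S fun Θ => {x : Fin n → ℝ | c.eval Θ - t < x ξ ∧ x ξ < c.eval Θ + t} :=
  shiftFamily_coord ξ c (measurableSet_Ioo (a := -t) (b := t)) (by linarith) (fun _ h => h)
    fun Θ => by
      ext x
      simp only [Set.mem_ofPred_eq, Set.mem_Ioo]
      constructor <;> rintro ⟨h1, h2⟩ <;> constructor <;> linarith

/-- The hypotheses exclude the two null sets that could occur: the empty set, and the hyperplane of
an unsmoothed equality. A smoothed equality is a strip of positive width since δ > 0. -/
theorem shiftFamily_smooth {δ : ℝ} (hδ : 0 < δ) {V : Finset (Fin n)} {b : BExpr n m}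
    (hb : ∀ ξ c, b = .cmp ξ .eq c → ξ ∈ V) (hff : b ≠ .ff) :
    ShiftFamily S fun Θ => b.smooth δ Θ V := by
  cases b with
  | tt => exact shiftFamily_univ
  | ff => exact absurd rfl hff
  | cmp ξ r c =>
    by_cases h : ξ ∈ V
    · cases r <;> simp only [BExpr.smooth, h, if_true]
      · simpa only [← sub_eq_add_neg] using shiftFamily_lt ξ c (-δ)
      · exact shiftFamily_lt ξ c δ
      · exact shiftFamily_strip ξ c hδ
      · simpa only [← sub_eq_add_neg] using shiftFamily_gt ξ c (-δ)
      · exact shiftFamily_gt ξ c δ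
    · cases r <;> simp only [BExpr.smooth, h, if_false, BExpr.toSet]
      · simpa using shiftFamily_lt ξ c 0
      · simpa using shiftFamily_le ξ c 0
      · exact absurd (hb ξ c rfl) h
      · simpa using shiftFamily_ge ξ c 0
      · simpa using shiftFamily_gt ξ c 0

/-- The complement of a half-space is a half-space; among guards only `tt` has an empty complement.
-/
theorem shiftFamily_smooth_compl {δ : ℝ} {V : Finset (Fin n)} {b : BExpr n m}
    (hb : b.IsGuard) (htt : b ≠ .tt) :
    ShiftFamily S fun Θ => (b.smooth δ Θ V)ᶜ := by
  cases b with
  | tt => exact absurd rfl htt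
  | ff => simpa [BExpr.smooth, BExpr.toSet] using shiftFamily_univ
  | cmp ξ r c =>
    by_cases h : ξ ∈ V
    · cases r <;> simp only [BExpr.smooth, h, if_true, Set.compl_ofPred, not_lt]
      · simpa only [← sub_eq_add_neg] using shiftFamily_ge ξ c (-δ)
      · exact shiftFamily_ge ξ c δ
      · exact hb.elim
      · simpa only [← sub_eq_add_neg] using shiftFamily_le ξ c (-δ)
      · exact shiftFamily_le ξ c δ
    · cases r <;> simp only [BExpr.smooth, h, if_false, BExpr.toSet, Set.compl_ofPred, not_lt,
        not_le]
      · simpa using shiftFamily_ge ξ c 0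
      · simpa using shiftFamily_gt ξ c 0
      · exact hb.elim
      · simpa using shiftFamily_lt ξ c 0
      · simpa using shiftFamily_le ξ c 0

end Predicates

/-! ## Differentiable states -/

/-- A family of states with a differentiable nonnegative probability, a differentiable mixture
and a constant set of smoothed variables. -/
structure DiffState {n m : ℕ} (S : Set (Fin m → ℝ)) (s : (Fin m → ℝ) → State n) : Prop where
  p_nonneg : ∀ Θ ∈ S, 0 ≤ (s Θ).p
  p_diff : DifferentiableOn ℝ (fun Θ => (s Θ).p) S
  mix : MixOn S (fun Θ => (s Θ).D) fun _ => 1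
  V_const : ∃ V, ∀ Θ ∈ S, (s Θ).V = V

/-- The constraints which a node puts on the parameters (and on its predicate). -/
def Node.Admissible {n m : ℕ} (Θ : Fin m → ℝ) : Node n m → Prop
  | .skip => True
  | .assign ξ (.lin a a₀) => ξ ∈ (Expr.lin a a₀).vars → (a ξ).eval Θ ≠ 0
  | .assign _ (.prod _ _) => True
  | .rnd _ gm =>
      (∀ g ∈ gm, 0 ≤ g.weight.eval Θ ∧ 0 ≤ g.std.eval Θ ∧
        ∀ i, g.std = .param i → Θ i ≠ 0) ∧
      (gm.map fun g => g.weight.eval Θ).sum = 1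
  | .test b _ => b.IsGuard
  | .observe _ => True

section States

variable {n m : ℕ} {S : Set (Fin m → ℝ)} {s s' : (Fin m → ℝ) → State n}

theorem DiffState.congr (h : DiffState S s) (hs : ∀ Θ ∈ S, s' Θ = s Θ) : DiffState S s' where
  p_nonneg Θ hΘ := by rw [hs Θ hΘ]; exact h.p_nonneg Θ hΘ
  p_diff := h.p_diff.congr fun Θ hΘ => by rw [hs Θ hΘ]
  mix := h.mix.congr fun Θ hΘ => by rw [hs Θ hΘ]
  V_const := by
    obtain ⟨V, hV⟩ := h.V_const
    exact ⟨V, fun Θ hΘ => by rw [hs Θ hΘ, hV Θ hΘ]⟩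

theorem diffState_entry : DiffState S fun _ => entry n where
  p_nonneg _ _ := zero_le_one
  p_diff := differentiableOn_const _
  mix := by
    refine ⟨[fun _ => ⟨1, 0, 1⟩], fun _ _ => rfl, fun f hf => ?_, fun _ _ => by simp⟩
    rw [List.mem_singleton] at hf
    subst hf
    exact ⟨fun _ _ => zero_le_one, differentiableOn_const _, fun _ => differentiableOn_const _,
      fun _ _ => differentiableOn_const _, fun _ _ => Matrix.PosDef.one⟩
  V_const := ⟨∅, fun _ _ => rfl⟩

theorem DiffState.assignStep (h : DiffState S s) {ε : ℝ} (hε : 0 < ε) {ξ : Fin n} {e : Expr n m}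
    (he : ∀ Θ ∈ S, (Node.assign ξ e).Admissible Θ) :
    DiffState S fun Θ => assignStep ε Θ ξ e (s Θ) where
  p_nonneg := h.p_nonneg
  p_diff := h.p_diff
  mix := by
    have hw : ∀ Θ ∈ S, ((s Θ).D.map fun g => g.weight).sum = 1 := fun Θ hΘ => h.mix.sum_weight hΘ
    cases e with
    | prod j k => exact h.mix.map (fun f hf => hf.assign_prod ξ j k) hw
    | lin a a₀ =>
      have ha := fun i => (a i).differentiableOn_eval S
      refine h.mix.map (fun f hf => ?_) hw
      -- Occurrence is syntactic, so the same case holds for all Θ. Either admissibility makes the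
      -- coefficient of ξ nonzero, or the noise ε > 0 is present.
      by_cases hξ : ξ ∈ (Expr.lin a a₀).vars
      · simp only [hξ, if_true]
        exact hf.assign_lin ha (a₀.differentiableOn_eval S) fun Θ hΘ => he Θ hΘ hξ
      · simp only [hξ, if_false]
        exact hf.assign_noise hf.nonneg hf.weight ξ ha (a₀.differentiableOn_eval S)
          (differentiableOn_const 0) (differentiableOn_const ε) fun _ _ => hε.ne'
  V_const := by
    obtain ⟨V, hV⟩ := h.V_const
    exact ⟨if e.vars ⊆ V then insert ξ V else V, fun Θ hΘ => by
      simp only [DeGAS.assignStep, hV Θ hΘ]⟩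

theorem MixOn.flatMap_map {E : Type*} [NormedAddCommGroup E] [NormedSpace ℝ E] {S : Set E}
    {D : E → GM n} {W W' : E → ℝ} (h : MixOn S D W) {α : Type*} {l : List α}
    {G : α → E → GComp n → GComp n}
    (hG : ∀ a ∈ l, ∀ f, DiffComp S f → DiffComp S fun Θ => G a Θ (f Θ))
    (hW : ∀ Θ ∈ S, ∀ g, (l.map fun a => (G a Θ g).weight).sum = g.weight * W' Θ) :
    MixOn S (fun Θ => (D Θ).flatMap fun g => l.map fun a => G a Θ g) fun Θ => W Θ * W' Θ := by
  obtain ⟨L, h1, h2, h3⟩ := h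
  refine ⟨L.flatMap fun f => l.map fun a Θ => G a Θ (f Θ), fun Θ hΘ => ?_, fun f hf => ?_,
    fun Θ hΘ => ?_⟩
  · simp [h1 Θ hΘ, List.flatMap_map, List.map_flatMap, Function.comp_def]
  · obtain ⟨f', hf', hf⟩ := List.mem_flatMap.1 hf
    obtain ⟨a, ha, rfl⟩ := List.mem_map.1 hf
    exact hG a ha f' (h2 f' hf')
  · beta_reduce
    rw [← h3 Θ hΘ, ← list_sum_map_mul_right, List.map_flatMap, List.flatMap_def, List.sum_flatten]
    simp only [List.map_map, Function.comp_def, hW Θ hΘ]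

theorem DiffState.rndStep (h : DiffState S s) {ε : ℝ} (hε : 0 < ε) {ξ : Fin n}
    {gm : List (RndComp m)} (hgm : ∀ Θ ∈ S, (Node.rnd ξ gm : Node n m).Admissible Θ) :
    DiffState S fun Θ => rndStep ε Θ ξ gm (s Θ) := by
  classical
  -- A standard deviation given by a parameter never vanishes on S, and a constant one does not
  -- vary. The case distinction in the semantics therefore never switches on S, which excludes a
  -- jump and keeps V constant.
  have hstd : ∀ r ∈ gm, (∀ Θ ∈ S, r.std.eval Θ = 0) ∨ ∀ Θ ∈ S, r.std.eval Θ ≠ 0 := by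
    intro r hr
    cases hc : r.std with
    | const c =>
      by_cases h0 : c = 0
      · exact .inl fun _ _ => h0
      · exact .inr fun _ _ => h0
    | param i => exact .inr fun Θ hΘ => ((hgm Θ hΘ).1 r hr).2.2 i hc
  refine ⟨h.p_nonneg, h.p_diff, ?_, ?_⟩
  · have h1 := h.mix.flatMap_map (l := gm) (W' := fun _ => 1) (G := fun r Θ g =>
      momentMatch (g.weight * r.weight.eval Θ) (tensor ξ (dropVar ξ g.law)
        (normal (r.mean.eval Θ) (if r.std.eval Θ = 0 then ε else r.std.eval Θ))))
      (fun r hr f hf => ?_) fun Θ hΘ g => ?_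
    · simpa only [DeGAS.rndStep, mul_one] using h1
    · refine hf.rnd
        (fun Θ hΘ => mul_nonneg (hf.nonneg Θ hΘ) ((hgm Θ hΘ).1 r hr).1)
        (hf.weight.mul (r.weight.differentiableOn_eval S)) ξ (r.mean.differentiableOn_eval S)
        (s := fun Θ => if r.std.eval Θ = 0 then ε else r.std.eval Θ) ?_ fun Θ hΘ => ?_
      · obtain h0 | h0 := hstd r hr
        · exact (differentiableOn_const ε).congr fun Θ hΘ => if_pos (h0 Θ hΘ)
        · exact (r.std.differentiableOn_eval S).congr fun Θ hΘ => if_neg (h0 Θ hΘ)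
      · split_ifs with h0
        exacts [hε.ne', h0]
    · simp only [momentMatch]
      rw [list_sum_map_mul_left, (hgm Θ hΘ).2]
  · obtain ⟨V, hV⟩ := h.V_const
    refine ⟨if ∃ r ∈ gm, r.std = .const 0 then insert ξ V else V, fun Θ hΘ => ?_⟩
    have : (∃ r ∈ gm, r.std.eval Θ = 0) ↔ ∃ r ∈ gm, r.std = .const 0 := by
      refine ⟨fun ⟨r, hr, h0⟩ => ⟨r, hr, ?_⟩, fun ⟨r, hr, h0⟩ => ⟨r, hr, by rw [h0]; rfl⟩⟩
      cases hc : r.std with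
      | const c =>
        rw [hc] at h0
        exact congrArg _ h0
      | param i =>
        rw [hc] at h0
        exact absurd h0 (((hgm Θ hΘ).1 r hr).2.2 i hc)
    simp only [DeGAS.rndStep, this, hV Θ hΘ]

theorem condStep_empty (s : State n) : condStep ∅ s = ⟨0, s.D, s.V⟩ := by
  have : GM.prob s.D ∅ = 0 := by simp [GM.prob]
  rw [condStep, if_pos this]

theorem DiffState.condStep_empty (h : DiffState S s) :
    DiffState S fun Θ => condStep ∅ (s Θ) := by
  simp only [DeGAS.condStep_empty]
  exact ⟨fun _ _ => le_rfl, differentiableOn_const 0, h.mix, h.V_const⟩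

theorem DiffState.prob_pos (h : DiffState S s) {A : (Fin m → ℝ) → Set (Fin n → ℝ)}
    (hA : ShiftFamily S A) {Θ : Fin m → ℝ} (hΘ : Θ ∈ S) : 0 < GM.prob (s Θ).D (A Θ) :=
  h.mix.sum_pos (r := fun g => g.law.real (A Θ)) hΘ fun _ hf => hf.real_pos hA hΘ

theorem DiffState.condStep (h : DiffState S s) {A : (Fin m → ℝ) → Set (Fin n → ℝ)}
    (hA : ShiftFamily S A) : DiffState S fun Θ => condStep (A Θ) (s Θ) := by
  have hpos := fun Θ hΘ => h.prob_pos hA (Θ := Θ) hΘ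
  have hdiff : DifferentiableOn ℝ (fun Θ => GM.prob (s Θ).D (A Θ)) S :=
    h.mix.differentiableOn_sum (k := fun Θ g => g.weight * g.law.real (A Θ)) fun f hf =>
      hf.weight.mul (hf.differentiableOn_real hA)
  -- Since the event has positive probability throughout S, only the second branch of `condStep`
  -- occurs.
  refine DiffState.congr (s := fun Θ =>
    { p := (s Θ).p * GM.prob (s Θ).D (A Θ)
      D := (s Θ).D.map fun g =>
        momentMatch (g.weight * g.law.real (A Θ) / GM.prob (s Θ).D (A Θ))
          (ProbabilityTheory.cond g.law (A Θ))
      V := (s Θ).V }) ⟨?_, h.p_diff.mul hdiff, ?_, h.V_const⟩ fun Θ hΘ => ?_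
  · exact fun Θ hΘ => mul_nonneg (h.p_nonneg Θ hΘ) (hpos Θ hΘ).le
  · refine h.mix.map (fun f hf => hf.cond (fun Θ hΘ => ?_) ?_ hA) fun Θ hΘ => ?_
    · exact div_nonneg (mul_nonneg (hf.nonneg Θ hΘ) measureReal_nonneg) (hpos Θ hΘ).le
    · simp only [div_eq_mul_inv]
      exact (hf.weight.mul (hf.differentiableOn_real hA)).mul
        (hdiff.inv fun Θ hΘ => (hpos Θ hΘ).ne')
    · simp only [momentMatch, div_eq_mul_inv, list_sum_map_mul_right]
      exact mul_inv_cancel₀ (hpos Θ hΘ).ne'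
  · rw [DeGAS.condStep, if_neg (hpos Θ hΘ).ne']

theorem DiffState.slice_pos (h : DiffState S s) (ξ : Fin n) (c : ℝ) {Θ : Fin m → ℝ}
    (hΘ : Θ ∈ S) : 0 < GM.slice (s Θ).D ξ c :=
  h.mix.sum_pos (r := fun g => g.slice ξ c) hΘ fun _ hf => hf.slice_pos ξ c hΘ

theorem DiffState.observeEqStep (h : DiffState S s) {ε : ℝ} (hε : 0 < ε) (ξ : Fin n)
    (c : Coef m) : DiffState S fun Θ => observeEqStep ε ξ (c.eval Θ) (s Θ) := by
  have hc := c.differentiableOn_eval S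
  have hpos := fun Θ hΘ => h.slice_pos ξ (c.eval Θ) (Θ := Θ) hΘ
  have hdiff : DifferentiableOn ℝ (fun Θ => GM.slice (s Θ).D ξ (c.eval Θ)) S :=
    h.mix.differentiableOn_sum (k := fun Θ g => g.weight * g.slice ξ (c.eval Θ)) fun f hf =>
      hf.weight.mul (hf.differentiableOn_slice ξ hc)
  refine ⟨fun Θ hΘ => mul_nonneg (h.p_nonneg Θ hΘ) (hpos Θ hΘ).le, h.p_diff.mul hdiff, ?_, ?_⟩
  · refine h.mix.map (G := fun Θ g =>
      momentMatch (g.weight * g.slice ξ (c.eval Θ) / GM.slice (s Θ).D ξ (c.eval Θ))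
        (tensor ξ (g.condSlice ξ (c.eval Θ)) (normal (c.eval Θ) ε)))
      (fun f hf => hf.condSlice (fun Θ hΘ => ?_) ?_ ξ hc (differentiableOn_const ε)
        fun _ _ => hε.ne') fun Θ hΘ => ?_
    · exact div_nonneg (mul_nonneg (hf.nonneg Θ hΘ) (hf.slice_pos ξ _ hΘ).le) (hpos Θ hΘ).le
    · simp only [div_eq_mul_inv]
      exact (hf.weight.mul (hf.differentiableOn_slice ξ hc)).mul
        (hdiff.inv fun Θ hΘ => (hpos Θ hΘ).ne')
    · simp only [momentMatch, div_eq_mul_inv, list_sum_map_mul_right]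
      exact mul_inv_cancel₀ (hpos Θ hΘ).ne'
  · obtain ⟨V, hV⟩ := h.V_const
    exact ⟨insert ξ V, fun Θ hΘ => by simp only [DeGAS.observeEqStep, hV Θ hΘ]⟩

/-! ## Nodes -/

theorem condStep_p_of_prob_pos {A : Set (Fin n → ℝ)} {s : State n} (h : 0 < GM.prob s.D A) :
    (DeGAS.condStep A s).p = s.p * GM.prob s.D A := by
  rw [DeGAS.condStep, if_neg h.ne']

theorem exactCond_empty (q : ℝ × Measure (Fin n → ℝ)) : (exactCond ∅ q).1 = 0 := by
  simp [exactCond]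

theorem exactCond_of_zero (A : Set (Fin n → ℝ)) {q : ℝ × Measure (Fin n → ℝ)} (hq : q.1 = 0) :
    (exactCond A q).1 = 0 := by
  unfold exactCond
  split_ifs <;> simp [hq]

/-- Exact probability zero is absorbing, so one impossible node rules out the whole path. -/
theorem exactNode_of_zero (Θ : Fin m → ℝ) (v : Node n m) {q : ℝ × Measure (Fin n → ℝ)}
    (hq : q.1 = 0) : (exactNode Θ v q).1 = 0 := by
  cases v with
  | skip => exact hq
  | assign ξ e => exact hq
  | rnd ξ gm => exact hq
  | test b o => cases o <;> exact exactCond_of_zero _ hq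
  | observe b =>
    cases b with
    | tt => exact exactCond_of_zero _ hq
    | ff => exact exactCond_of_zero _ hq
    | cmp ξ r c =>
      cases r with
      | eq =>
        simp only [exactNode, exactObserveEq]
        split_ifs
        exacts [exactCond_of_zero _ hq, by simp [hq], rfl]
      | _ => exact exactCond_of_zero _ hq

/-- The effect of a node: either the probability is multiplied by a positive number for every
`Θ ∈ S`, or the path becomes infeasible in both semantics. -/
def NodeEffect (S : Set (Fin m → ℝ)) (v : Node n m) (s s' : (Fin m → ℝ) → State n) : Prop :=
  (∃ r : (Fin m → ℝ) → ℝ, ∀ Θ ∈ S, 0 < r Θ ∧ (s' Θ).p = (s Θ).p * r Θ) ∨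
    ∀ Θ ∈ S, (s' Θ).p = 0 ∧ ∀ q, (exactNode Θ v q).1 = 0

theorem DiffState.condStep_effect (h : DiffState S s) (v : Node n m)
    {A : (Fin m → ℝ) → Set (Fin n → ℝ)} (hA : ShiftFamily S A) :
    DiffState S (fun Θ => DeGAS.condStep (A Θ) (s Θ)) ∧
      NodeEffect S v s fun Θ => DeGAS.condStep (A Θ) (s Θ) :=
  ⟨h.condStep hA, .inl ⟨fun Θ => GM.prob (s Θ).D (A Θ), fun _ hΘ =>
    ⟨h.prob_pos hA hΘ, condStep_p_of_prob_pos (h.prob_pos hA hΘ)⟩⟩⟩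

theorem DiffState.condStep_empty_effect (h : DiffState S s) {v : Node n m}
    (hv : ∀ Θ q, (exactNode Θ v q).1 = 0) :
    DiffState S (fun Θ => DeGAS.condStep ∅ (s Θ)) ∧
      NodeEffect S v s fun Θ => DeGAS.condStep ∅ (s Θ) :=
  ⟨h.condStep_empty, .inr fun Θ _ => ⟨by simp only [DeGAS.condStep_empty], hv Θ⟩⟩

theorem NodeEffect.of_eq {v : Node n m} (h : ∀ Θ ∈ S, (s' Θ).p = (s Θ).p) :
    NodeEffect S v s s' :=
  .inl ⟨fun _ => 1, fun Θ hΘ => ⟨one_pos, by rw [h Θ hΘ, mul_one]⟩⟩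

theorem NodeEffect.congr {v : Node n m} {s'' : (Fin m → ℝ) → State n} (h : NodeEffect S v s s')
    (hs : ∀ Θ ∈ S, s'' Θ = s' Θ) : NodeEffect S v s s'' := by
  obtain ⟨r, hr⟩ | h := h
  · exact .inl ⟨r, fun Θ hΘ => by rw [hs Θ hΘ]; exact hr Θ hΘ⟩
  · exact .inr fun Θ hΘ => by rw [hs Θ hΘ]; exact h Θ hΘ

theorem DiffState.node (h : DiffState S s) {ε δ : ℝ} (hε : 0 < ε) (hδ : 0 < δ) {v : Node n m}
    (hS : S.Nonempty) (hv : ∀ Θ ∈ S, v.Admissible Θ) :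
    DiffState S (fun Θ => node ε δ Θ v (s Θ)) ∧ NodeEffect S v s fun Θ => node ε δ Θ v (s Θ) := by
  obtain ⟨V, hV⟩ := h.V_const
  -- Allows the set of smoothed variables of `s Θ` to be replaced by its constant value V before the
  -- node is analysed.
  have key : ∀ t : (Fin m → ℝ) → State n,
      DiffState S t ∧ NodeEffect S v s t → (∀ Θ ∈ S, DeGAS.node ε δ Θ v (s Θ) = t Θ) →
      DiffState S (fun Θ => DeGAS.node ε δ Θ v (s Θ)) ∧
        NodeEffect S v s fun Θ => DeGAS.node ε δ Θ v (s Θ) :=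
    fun t ht hs => ⟨ht.1.congr hs, ht.2.congr hs⟩
  cases v with
  | skip => exact ⟨h, .of_eq fun _ _ => rfl⟩
  | assign ξ e => exact ⟨h.assignStep hε hv, .of_eq fun _ _ => rfl⟩
  | rnd ξ gm => exact ⟨h.rndStep hε hv, .of_eq fun _ _ => rfl⟩
  | test b o =>
    -- Being a guard does not depend on Θ, so one point of S is enough to extract it.
    obtain ⟨Θ₀, hΘ₀⟩ := hS
    have hb : b.IsGuard := hv Θ₀ hΘ₀
    cases o with
    | true =>
      by_cases hff : b = .ff
      · subst hff
        exact h.condStep_empty_effect fun Θ q => exactCond_empty q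
      · refine key _ (h.condStep_effect _ (shiftFamily_smooth hδ (V := V) ?_ hff)) fun Θ hΘ => ?_
        · rintro ξ c rfl
          exact hb.elim
        · simp only [DeGAS.node, hV Θ hΘ]
    | false =>
      by_cases htt : b = .tt
      · subst htt
        refine key _ (h.condStep_empty_effect fun Θ q => ?_) fun Θ hΘ => ?_
        · simp only [exactNode, BExpr.toSet, Set.compl_univ]
          exact exactCond_empty q
        · simp only [DeGAS.node, BExpr.smooth, BExpr.toSet, Set.compl_univ]
      · refine key _ (h.condStep_effect _ (shiftFamily_smooth_compl (δ := δ) (V := V) hb htt))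
          fun Θ hΘ => ?_
        simp only [DeGAS.node, hV Θ hΘ]
  | observe b =>
    have hcond : (∀ ξ c, b = .cmp ξ .eq c → ξ ∈ V) → b ≠ .ff →
        (∀ Θ ∈ S, DeGAS.node ε δ Θ (.observe b) (s Θ) =
          DeGAS.condStep (b.smooth δ Θ V) (s Θ)) →
        DiffState S (fun Θ => DeGAS.node ε δ Θ (.observe b) (s Θ)) ∧
        NodeEffect S (.observe b) s fun Θ => DeGAS.node ε δ Θ (.observe b) (s Θ) :=
      fun h1 h2 h3 => key _ (h.condStep_effect _ (shiftFamily_smooth hδ h1 h2)) h3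
    cases b with
    | tt => exact hcond (by simp) (by simp) fun Θ hΘ => rfl
    | ff => exact h.condStep_empty_effect fun Θ q => exactCond_empty q
    | cmp ξ r c =>
      by_cases hr : r = .eq
      · subst hr
        by_cases hξ : ξ ∈ V
        · refine hcond (by rintro _ _ ⟨⟩; exact hξ) (by simp) fun Θ hΘ => ?_
          simp only [DeGAS.node, hV Θ hΘ, hξ, if_true]
        · refine key (fun Θ => DeGAS.observeEqStep ε ξ (c.eval Θ) (s Θ))
            ⟨h.observeEqStep hε ξ c, .inl ⟨fun Θ => GM.slice (s Θ).D ξ (c.eval Θ),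
              fun Θ hΘ => ⟨h.slice_pos ξ _ hΘ, rfl⟩⟩⟩ fun Θ hΘ => ?_
          simp only [DeGAS.node, hV Θ hΘ, hξ, if_false]
      · refine hcond (by rintro _ _ ⟨⟩; exact absurd rfl hr) (by simp) fun Θ hΘ => ?_
        cases r with
        | eq => exact absurd rfl hr
        | _ => simp only [DeGAS.node, hV Θ hΘ]

end States

/-! ## Paths and programs -/

section Paths

variable {n m : ℕ} {S : Set (Fin m → ℝ)}

/-- The two semantics are compared only through the alternative `hq`: the smoothed probability is
positive on all of S, or the exact one at Θ₀ is already zero. No relation between the two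
distributions is needed, because an infeasible node annihilates every exact state. -/
theorem diffState_foldl {ε δ : ℝ} (hε : 0 < ε) (hδ : 0 < δ) {Θ₀ : Fin m → ℝ} (hΘ₀ : Θ₀ ∈ S)
    (ω : List (Node n m)) (hω : ∀ v ∈ ω, ∀ Θ ∈ S, v.Admissible Θ)
    {s : (Fin m → ℝ) → State n} (hs : DiffState S s) {q : ℝ × Measure (Fin n → ℝ)}
    (hq : (∀ Θ ∈ S, 0 < (s Θ).p) ∨ q.1 = 0) :
    DiffState S (fun Θ => ω.foldl (fun s v => node ε δ Θ v s) (s Θ)) ∧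
      ((∀ Θ ∈ S, 0 < (ω.foldl (fun s v => node ε δ Θ v s) (s Θ)).p) ∨
        (ω.foldl (fun q v => exactNode Θ₀ v q) q).1 = 0) := by
  induction ω generalizing s q with
  | nil => exact ⟨hs, hq⟩
  | cons v ω ih =>
    obtain ⟨h1, h2⟩ := hs.node hε hδ ⟨Θ₀, hΘ₀⟩ (hω v List.mem_cons_self)
    refine ih (fun u hu => hω u (List.mem_cons_of_mem _ hu)) h1 ?_
    obtain hq | hq := hq
    · obtain ⟨r, hr⟩ | h2 := h2
      · exact .inl fun Θ hΘ => by
          rw [(hr Θ hΘ).2]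
          exact mul_pos (hq Θ hΘ) (hr Θ hΘ).1
      · exact .inr ((h2 Θ₀ hΘ₀).2 q)
    · exact .inr (exactNode_of_zero Θ₀ v hq)

theorem diffState_path {ε δ : ℝ} (hε : 0 < ε) (hδ : 0 < δ) {Θ₀ : Fin m → ℝ} (hΘ₀ : Θ₀ ∈ S)
    {ω : List (Node n m)} (hω : ∀ v ∈ ω, ∀ Θ ∈ S, v.Admissible Θ) :
    DiffState S (fun Θ => path ε δ Θ ω) ∧
      (0 < (exactPath Θ₀ ω).1 → ∀ Θ ∈ S, 0 < (path ε δ Θ ω).p) := by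
  obtain ⟨h1, h2⟩ := diffState_foldl hε hδ hΘ₀ ω hω diffState_entry
    (q := (1, gaussian 0 1)) (.inl fun _ _ => one_pos)
  exact ⟨h1, fun h => h2.resolve_right h.ne'⟩

theorem Prog.Admissible.node {Θ : Fin m → ℝ} {P : Prog n m} (hP : P.Admissible Θ)
    {ω : List (Node n m)} (hω : ω ∈ P.paths) {v : Node n m} (hv : v ∈ ω) : v.Admissible Θ := by
  induction P generalizing ω with
  | skip =>
    rw [Prog.paths, List.mem_singleton] at hω
    subst hω
    rw [List.mem_singleton] at hv
    subst hv
    trivial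
  | assign ξ e =>
    rw [Prog.paths, List.mem_singleton] at hω
    subst hω
    rw [List.mem_singleton] at hv
    subst hv
    cases e <;> exact hP
  | rnd ξ gm =>
    rw [Prog.paths, List.mem_singleton] at hω
    subst hω
    rw [List.mem_singleton] at hv
    subst hv
    exact hP
  | ite b hb P Q ihP ihQ =>
    rw [Prog.paths, List.mem_append, List.mem_map, List.mem_map] at hω
    obtain ⟨ω', hω', rfl⟩ | ⟨ω', hω', rfl⟩ := hω
    · obtain rfl | hv := List.mem_cons.1 hv
      exacts [hb, ihP hP.1 hω' hv]
    · obtain rfl | hv := List.mem_cons.1 hv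
      exacts [hb, ihQ hP.2 hω' hv]
  | observe b =>
    rw [Prog.paths, List.mem_singleton] at hω
    subst hω
    rw [List.mem_singleton] at hv
    subst hv
    trivial
  | seq P Q ihP ihQ =>
    rw [Prog.paths, List.mem_flatMap] at hω
    obtain ⟨ω₁, hω₁, hω⟩ := hω
    obtain ⟨ω₂, hω₂, rfl⟩ := List.mem_map.1 hω
    obtain hv | hv := List.mem_append.1 hv
    exacts [ihP hP.1 hω₁ hv, ihQ hP.2 hω₂ hv]

end Paths

end DeGAS

end

/-! ### From paths to the whole program -/

theorem theorem1 {n m : ℕ} (ε δ : ℝ) (hε : 0 < ε) (hδ : 0 < δ)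
    (dom : Fin m → Set ℝ) (hdom : ∀ i, (dom i).OrdConnected)
    (P : DeGAS.Prog n m)
    (hP : ∃ Θ ∈ P.feasible dom, P.Valid Θ) :
    -- every path returns a differentiable probability and a differentiable Gaussian mixture,
    -- and a set of smoothed variables that does not depend on the parameters
    (∀ ω ∈ P.paths,
      DifferentiableOn ℝ (fun Θ => (DeGAS.path ε δ Θ ω).p) (P.feasible dom) ∧
      DeGAS.DifferentiableGM (fun Θ => (DeGAS.path ε δ Θ ω).D) (P.feasible dom) ∧
      (∀ x, DifferentiableOn ℝ (fun Θ => DeGAS.GM.pdf (DeGAS.path ε δ Θ ω).D x)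
        (P.feasible dom)) ∧
      (∃ V' : Finset (Fin n), ∀ Θ ∈ P.feasible dom, (DeGAS.path ε δ Θ ω).V = V')) ∧
    -- and so does the program
    (∀ Θ ∈ P.feasible dom, 0 < DeGAS.progProb ε δ Θ P) ∧
    DifferentiableOn ℝ (fun Θ => DeGAS.progProb ε δ Θ P) (P.feasible dom) ∧
    DeGAS.DifferentiableGM (fun Θ => DeGAS.progDist ε δ Θ P) (P.feasible dom) ∧
    (∀ x, DifferentiableOn ℝ (fun Θ => DeGAS.GM.pdf (DeGAS.progDist ε δ Θ P) x)
      (P.feasible dom)) := by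
  obtain ⟨Θ₀, hΘ₀, ω₀, hω₀, hpos₀⟩ := hP
  have hpath := fun ω (hω : ω ∈ P.paths) => DeGAS.diffState_path (S := P.feasible dom) hε hδ hΘ₀
    (ω := ω) fun v hv Θ hΘ => hΘ.2.node hω hv
  -- The path ω₀ that is possible at Θ₀ has positive smoothed probability everywhere on S, and the
  -- other paths contribute nonnegative terms.
  have hprob : ∀ Θ ∈ P.feasible dom, 0 < DeGAS.progProb ε δ Θ P := fun Θ hΘ =>
    ((hpath ω₀ hω₀).2 hpos₀ Θ hΘ).trans_le (List.single_le_sum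
      (fun p hp => by
        obtain ⟨ω, hω, rfl⟩ := List.mem_map.1 hp
        exact (hpath ω hω).1.p_nonneg Θ hΘ) _ (List.mem_map_of_mem hω₀))
  have hdiff : DifferentiableOn ℝ (fun Θ => DeGAS.progProb ε δ Θ P) (P.feasible dom) :=
    DeGAS.differentiableOn_list_sum (h := fun ω Θ => (DeGAS.path ε δ Θ ω).p)
      fun ω hω => (hpath ω hω).1.p_diff
  have hmix : DeGAS.MixOn (P.feasible dom) (fun Θ => DeGAS.progDist ε δ Θ P) fun _ => 1 := by
    obtain ⟨L, h1, h2, h3⟩ := DeGAS.MixOn.flatMap (S := P.feasible dom) (L := P.paths)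
      (D := fun ω Θ => (DeGAS.path ε δ Θ ω).D)
      (q := fun ω Θ => (DeGAS.path ε δ Θ ω).p / DeGAS.progProb ε δ Θ P)
      (fun ω hω => (hpath ω hω).1.mix)
      (fun ω hω Θ hΘ => div_nonneg ((hpath ω hω).1.p_nonneg Θ hΘ) (hprob Θ hΘ).le)
      fun ω hω => by
        simp only [div_eq_mul_inv]
        exact (hpath ω hω).1.p_diff.mul (hdiff.inv fun Θ hΘ => (hprob Θ hΘ).ne')
    refine ⟨L, h1, h2, fun Θ hΘ => ?_⟩
    rw [h3 Θ hΘ]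
    simp only [div_eq_mul_inv, DeGAS.list_sum_map_mul_right]
    exact mul_inv_cancel₀ (hprob Θ hΘ).ne'
  exact ⟨fun ω hω => ⟨(hpath ω hω).1.p_diff, (hpath ω hω).1.mix.differentiableGM,
    (hpath ω hω).1.mix.differentiableOn_pdf, (hpath ω hω).1.V_const⟩, hprob, hdiff,
    hmix.differentiableGM, hmix.differentiableOn_pdf⟩
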